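/- Let $\mu$ be a compactly supported probability measure on $[0,\infty)$ (a limiting spectral measure), and let $\lambda^-$ be the left endpoint of the support of $\mu$ restricted to $(0,\infty)$; assume $\lambda^->0$ (strongly convex regime). Let $r>0$, $\gamma>0$, $R,\widetilde R\ge 0$, $R+\widetilde R>0$. For $k\ge 0$ put $h_k(t)=\int_0^\infty x^k e^{-2\gamma t x}\,d\mu(x)$ and let $\psi_0$ be the (locally integrable) solution on $[0,\infty)$ of the Volterra equation $$\psi_0(t)=\tfrac R2 h_1(t)+\tfrac{\widetilde R}2\bigl(r h_0(t)+1-r\bigr)+\int_0^t\gamma^2 r\,h_2(t-s)\psi_0(s)\,ds .$$ Write $m=\int x\,d\mu(x)$, $\gamma_0=\bigl(\tfrac r2 m\bigr)^{-1}$, $\gamma_*=\bigl(\tfrac r2\int_0^\infty\frac{x^2}{x-\lambda^-}\,d\mu(x)\bigr)^{-1}$ (with $\gamma_*=0$ if the integral is infinite), $\psi_0(\infty)=\frac{\widetilde R}2\cdot\frac{r\mu(\{0\})+1-r}{1-\frac{\gamma r}2 m}$, and $\Delta(\lambda)=(R\lambda+\widetilde R r)\bigl(\tfrac2\gamma-rm\bigr)-\widetilde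 R r\lambda$. (1) If $\gamma_*<\gamma<\gamma_0$, there is a unique real $\lambda^*$ (the Malthusian exponent) with $\int_0^\infty e^{2\gamma\lambda^* t}\gamma^2 r h_2(t)\,dt=1$. It satisfies $0<\lambda^*<\lambda^-$ and is the unique solution in $(-\infty,\lambda^-]$ of $\frac r2\int_0^\infty\frac{x^2}{x-\lambda}\,d\mu(x)=\frac1\gamma$. Moreover $$\lim_{t\to\infty}e^{2\gamma\lambda^* t}\bigl(\psi_0(t)-\psi_0(\infty)\bigr)=\frac c\gamma,\qquad c=\frac{R\int\frac{x}{x-\lambda^*}d\mu+\widetilde R r\int\frac{1}{x-\lambda^*}d\mu-\widetilde R\frac{1-r}{\lambda^*}}{r\int\frac{x^2}{(x-\lambda^*)^2}d\mu},$$ so that $\psi_0(t)-\psi_0(\infty)\sim\frac c\gamma e^{-2\gamma\lambda^* t}$ whenever $c\ne0$. One has $c>0$ if and only if $\Delta(\lambda^*)>0$, and in particular $c>0$ if $\psi_0(\infty)=0$. (2) If $0<\gamma<\gamma_*$ and $\mu$ is regular at its left edge, that is, $\mu((\lambda^-,\lambda^-+t])\sim t^\alpha L(1/t)$ as $t\downarrow0$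 for some $\alpha>0$ and some function $L$ slowly varying at infinity (for example $L\equiv c_\mu$ a positive constant), then $$\lim_{t\to\infty}\frac{e^{2\gamma\lambda^- t}\bigl(\psi_0(t)-\psi_0(\infty)\bigr)}{t^{-\alpha}L(t)}=\kappa,\qquad \kappa=\frac{\gamma\,\Gamma(\alpha+1)\,\Delta(\lambda^-)}{4(2\gamma)^\alpha(1-\gamma/\gamma_*)^2},$$ so that $\psi_0(t)-\psi_0(\infty)\sim e^{-2\gamma\lambda^- t}g(t)$ with the regularly varying function $g(t)=\kappa\,t^{-\alpha}L(t)$ whenever $\kappa\neq0$. One has $\kappa>0$ if and only if $\Delta(\lambda^-)>0$, and in particular $\kappa>0$ if $\psi_0(\infty)=0$. -/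

import Mathlib

open MeasureTheory Set Filter Topology Asymptotics
open scoped ENNReal

namespace SGDVolterra

/-- The left endpoint `λ⁻` of the support of `μ` restricted to `(0, ∞)`. -/
noncomputable def leftEdge (μ : Measure ℝ) : ℝ :=
  sInf (μ.restrict (Ioi 0)).support

/-- The first moment `∫ x dμ(x)`. -/
noncomputable def firstMoment (μ : Measure ℝ) : ℝ := ∫ x, x ∂μ

/-- `h_k(t) = ∫ x ^ k e ^ (-2 γ t x) dμ(x)`. -/
noncomputable def h (μ : Measure ℝ) (γ : ℝ) (k : ℕ) (t : ℝ) : ℝ :=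
  ∫ x, x ^ k * Real.exp (-2 * γ * t * x) ∂μ

/-- The forcing function `z(t) = (R / 2) h_1(t) + (R̃ / 2) (r h_0(t) + (1 - r))`. -/
noncomputable def forcing (μ : Measure ℝ) (r R Rt γ t : ℝ) : ℝ :=
  R / 2 * h μ γ 1 t + Rt / 2 * (r * h μ γ 0 t + (1 - r))

/-- `ψ` is a (locally integrable) solution on `[0, ∞)` of the Volterra equation
`ψ(t) = z(t) + ∫_0^t γ ^ 2 r h_2(t - s) ψ(s) ds`. -/
structure IsVolterraSolution (μ : Measure ℝ) (r R Rt γ : ℝ) (ψ : ℝ → ℝ) : Prop where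
  intervalIntegrable : ∀ t, 0 ≤ t → IntervalIntegrable ψ volume 0 t
  equation : ∀ t, 0 ≤ t →
    ψ t = forcing μ r R Rt γ t + ∫ s in (0 : ℝ)..t, γ ^ 2 * r * h μ γ 2 (t - s) * ψ s

/-- The limiting value `ψ_0(∞) = (R̃ / 2) (r μ({0}) + (1 - r)) / (1 - (γ r / 2) ∫ x dμ(x))`. -/
noncomputable def psiInfty (μ : Measure ℝ) (r Rt γ : ℝ) : ℝ :=
  Rt / 2 * ((r * μ.real {0} + (1 - r)) / (1 - γ * r / 2 * firstMoment μ))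

/-- `∫ x ^ 2 / (x - lam) dμ(x)`, an integral with values in `[0, ∞]`. It is meant for a measure on
`[0, ∞)` and for `lam ≤ λ⁻`, where the integrand is nonnegative `μ`-almost everywhere. In `ℝ≥0∞`
one has `0 / 0 = 0` and `a / 0 = ∞` for `a ≠ 0`, so that a possible atom at `0` does not
contribute, and an atom at `lam > 0` makes the integral infinite. -/
noncomputable def resolventIntegral (μ : Measure ℝ) (lam : ℝ) : ℝ≥0∞ :=
  ∫⁻ x, ENNReal.ofReal (x ^ 2) / ENNReal.ofReal (x - lam) ∂μ

/-- The critical stepsize `γ_* = ((r / 2) ∫ x ^ 2 / (x - λ⁻) dμ(x))⁻¹`, which is `0` if the integral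
is infinite. -/
noncomputable def criticalStepsize (μ : Measure ℝ) (r : ℝ) : ℝ :=
  (ENNReal.ofReal (r / 2) * resolventIntegral μ (leftEdge μ))⁻¹.toReal

/-- The convergence threshold `γ_0 = ((r / 2) ∫ x dμ(x))⁻¹`. -/
noncomputable def maxStepsize (μ : Measure ℝ) (r : ℝ) : ℝ :=
  (r / 2 * firstMoment μ)⁻¹

/-- `lam` is a Malthusian exponent: `∫_0^∞ e ^ (2 γ lam t) γ ^ 2 r h_2(t) dt = 1`. The integrand is
nonnegative and the integral takes values in `[0, ∞]`. -/
def IsMalthusianExponent (μ : Measure ℝ) (r γ lam : ℝ) : Prop :=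
  ∫⁻ t in Ioi (0 : ℝ),
    ENNReal.ofReal (Real.exp (2 * γ * lam * t) * (γ ^ 2 * r * h μ γ 2 t)) = 1

/-- `L` is slowly varying (at infinity). -/
def IsSlowlyVarying (L : ℝ → ℝ) : Prop :=
  ∀ x, 0 < x → Tendsto (fun t => L (t * x) / L t) atTop (𝓝 1)

/-- `g` is regularly varying (at infinity). -/
def IsRegularlyVarying (g : ℝ → ℝ) : Prop :=
  ∃ (ρ : ℝ) (L : ℝ → ℝ), IsSlowlyVarying L ∧ ∀ t, 0 < t → g t = L t * t ^ ρ

/-- `μ` is left-edge-regular with index `α` and slowly varying function `L`: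
`μ((λ⁻, λ⁻ + t]) ~ t ^ α L(1 / t)` as `t ↓ 0`. -/
def IsLeftEdgeRegular (μ : Measure ℝ) (α : ℝ) (L : ℝ → ℝ) : Prop :=
  0 < α ∧ IsSlowlyVarying L ∧
    (fun t => μ.real (Ioc (leftEdge μ) (leftEdge μ + t))) ~[𝓝[>] 0]
      (fun t => t ^ α * L (1 / t))

/-- The constant of the regime `γ > γ_*`; it depends on `γ` only through the Malthusian exponent
`lam`. -/
noncomputable def supercriticalConst (μ : Measure ℝ) (r R Rt lam : ℝ) : ℝ :=
  (R * (∫ x, x / (x - lam) ∂μ) + Rt * r * (∫ x, 1 / (x - lam) ∂μ) - Rt * (1 - r) / lam) /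
    (r * (∫ x, x ^ 2 / (x - lam) ^ 2 ∂μ))

/-- `(R lam + R̃ r) (2 / γ - r ∫ x dμ(x)) - R̃ r lam`, the quantity that decides the sign of the
asymptotic constants. -/
noncomputable def signQuantity (μ : Measure ℝ) (r R Rt γ lam : ℝ) : ℝ :=
  (R * lam + Rt * r) * (2 / γ - r * firstMoment μ) - Rt * r * lam

/-- The constant of the regime `γ < γ_*` (with `γ / γ_* = ∫_0^∞ e ^ (2 γ λ⁻ t) γ ^ 2 r h_2(t) dt`). -/
noncomputable def subcriticalConst (μ : Measure ℝ) (r R Rt γ α : ℝ) : ℝ :=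
  γ * Real.Gamma (α + 1) * signQuantity μ r R Rt γ (leftEdge μ) /
    (4 * (2 * γ) ^ α * (1 - γ / criticalStepsize μ r) ^ 2)

end SGDVolterra

/-! Write `e = λ⁻` and `F(λ) = ∫ x² / (x - λ) dμ`. Since `h_1' = -2γ h_2`, subtracting `ψ_0(∞)`
cancels the constant terms, and the deviation `φ` solves a convolution equation involving only `μ`
on `(0, ∞)`: its forcing is `∫ (A x + B) e^{-2γtx} dμ` with `A = (R - γ r ψ_0(∞)) / 2` and `B = R̃ r
/ 2`, and its kernel is `γ² r h_2` (`IsVolterraSolution.exists_deviation`).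

By Tonelli, the kernel tilted by `e^{2γλt}` has mass `γ r F(λ) / 2`, so the Malthusian equation
reads `F(λ) = 2 / (γ r)`. Below `e` the function `F` is continuous and strictly increasing, with
`F(0) = m`; Fatou controls its value at the edge. Hence `γ < γ_0` and `γ > γ_*` are what put a root
in `(0, e)` (`existsUnique_resolvent_eq`).

Above `γ_*`, write `φ(t) = ∫ v(t, x) dμ(x)`, where `∂_t v = -2γ x v + γ² r x² ∫ v dμ`. This
generator is diagonal plus rank one and symmetric in `L²(x⁻² μ)`. Its ground state `x² / (x - λ*)`
has eigenvalue `-2γλ*`. On the orthogonal complement, completing a square gives the decay rate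
`2γe`, which is faster because `λ* < e` (`spectral_gap_inequality`, `sq_le_of_orthogonal_flow`). The
limit is therefore the contribution of the ground-state component of the initial datum
(`tendsto_exp_mul_of_malthusian`).

Below `γ_*`, tilting by `e^{2γet}` gives a renewal equation `a = f + K * a` with `I = ∫ K = γ / γ_*
< 1`. An Abelian theorem compares `K` and `f` with the mass of `μ` in `(e, e + 1/(2γt)]`; in
particular `K` is subexponential. In a convolution only the two ends of `[0, t]` then matter, so `a
/ K` tends to `(lim f/K + ∫ f / (1 - I)) / (1 - I)` (`tendsto_renewal_div_kernel`).

For the signs, `x/(x-λ) = 1 + λ/(x-λ)` and `x²/(x-λ) = x + λx/(x-λ)` express all the numerators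
through `∫ 1/(x-λ)`. Eliminating it shows that both constants are positive multiples of `Δ`. -/

namespace SGDVolterra

/-- A nonnegative function whose eventual upper bounds are improved by a factor `I < 1`
tends to zero. -/
lemma tendsto_zero_of_contracting {e : ℝ → ℝ} {I B : ℝ} (hI : I < 1) (hI0 : 0 ≤ I)
    (he : ∀ t, 0 ≤ e t) (hB : ∀ᶠ t in atTop, e t ≤ B)
    (hstep : ∀ S, (∀ᶠ t in atTop, e t ≤ S) → ∀ ε > 0, ∀ᶠ t in atTop, e t ≤ I * S + ε) :
    Tendsto e atTop (𝓝 0) := by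
  set A : Set ℝ := {S | ∀ᶠ t in atTop, e t ≤ S} with hA
  have hbdd : BddBelow A := ⟨0, fun S hS => by
    obtain ⟨t, ht⟩ := (show ∀ᶠ t in atTop, e t ≤ S from hS).exists
    exact (he t).trans ht⟩
  have hne : A.Nonempty := ⟨B, hB⟩
  have h0 : sInf A ≤ 0 := by
    by_contra! hpos
    set s := sInf A
    -- With this slack for both `S - s` and `ε`, `I * S + ε` is at most `I * s + (1 - I) * s / 2 <
    -- s`.
    have hδ : 0 < (1 - I) * s / 4 := by
      have : 0 < 1 - I := by linarith
      positivity
    obtain ⟨S, hS, hS'⟩ := exists_lt_of_csInf_lt hne (show sInf A < s + (1 - I) * s / 4 by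
      change s < _; linarith)
    have := csInf_le hbdd (show I * S + (1 - I) * s / 4 ∈ A from hstep S hS _ hδ)
    change s ≤ _ at this
    nlinarith [mul_le_mul_of_nonneg_left hS'.le hI0, mul_nonneg hI0 hδ.le]
  refine tendsto_order.2 ⟨fun b hb => Eventually.of_forall fun t => hb.trans_le (he t),
    fun b hb => ?_⟩
  obtain ⟨S, hS, hS'⟩ := exists_lt_of_csInf_lt hne (h0.trans_lt hb)
  filter_upwards [hS] with t ht using lt_of_le_of_lt ht hS'

/-! ### Defective renewal equations with subexponential kernel -/

section Renewal

variable {K f a : ℝ → ℝ}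

/-- The norm `N` of `a` in `L¹(0, T)` satisfies `N ≤ ‖f‖₁ + I N`, which bounds `N` uniformly in `T`
because `I < 1`. -/
lemma integrableOn_of_renewal (hKpos : ∀ t, 0 ≤ t → 0 < K t)
    (hKint : IntegrableOn K (Ioi 0)) (hI : ∫ t in Ioi 0, K t < 1)
    (hfint : IntegrableOn f (Ioi 0)) (ha : Continuous a)
    (heq : ∀ t, 0 ≤ t → a t = f t + ∫ s in (0 : ℝ)..t, K (t - s) * a s) :
    IntegrableOn a (Ioi 0) := by
  set I := ∫ t in Ioi 0, K t with hIdef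
  refine integrableOn_Ioi_of_intervalIntegral_norm_bounded
    ((∫ t in Ioi 0, |f t|) / (1 - I)) 0 (b := fun t : ℝ => t) (l := atTop)
    (fun i => (ha.integrableOn_Icc).mono_set Ioc_subset_Icc_self) tendsto_id ?_
  filter_upwards [eventually_ge_atTop 0] with T hT
  -- The truncation is integrable before `a` is known to be, and on `[0, T]` it has the same
  -- convolution with `K` as `|a|`.
  set aT : ℝ → ℝ := indicator (Iic T) (fun s => |a s|) with haT
  have haTint : IntegrableOn aT (Ioi 0) := by
    rw [haT, integrableOn_indicator_iff measurableSet_Iic]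
    exact (ha.abs.integrableOn_Icc (a := 0) (b := T)).mono_set fun x hx => ⟨hx.2.le, hx.1⟩
  have hconv := integrable_posConvolution (μ := volume) (ν := volume) haTint hKint
    (ContinuousLinearMap.mul ℝ ℝ)
  have hval := integral_posConvolution (μ := volume) (ν := volume) haTint hKint
    (ContinuousLinearMap.mul ℝ ℝ)
  simp only [ContinuousLinearMap.mul_apply'] at hval
  have haTval : ∫ x in Ioi 0, aT x = ∫ x in (0 : ℝ)..T, |a x| := by
    rw [haT, integral_indicator measurableSet_Iic, Measure.restrict_restrict measurableSet_Iic,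
      intervalIntegral.integral_of_le hT]
    congr 2
    ext x; simp [and_comm]
  set g : ℝ → ℝ := fun x => ∫ t in (0 : ℝ)..x, aT t * K (x - t) with hg
  have hgint : IntegrableOn g (Ioi 0) := by
    rw [← integrable_indicator_iff measurableSet_Ioi]
    simpa [posConvolution, hg] using hconv
  have hg0 : ∀ x ∈ Ioi (0 : ℝ), 0 ≤ g x := fun x hx => by
    refine intervalIntegral.integral_nonneg (le_of_lt hx) fun u hu => ?_
    exact mul_nonneg (indicator_nonneg (fun _ _ => abs_nonneg _) _)
      (hKpos _ (by linarith [hu.2])).le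
  have hgle : ∫ x in (0 : ℝ)..T, g x ≤ ∫ x in Ioi 0, g x := by
    rw [intervalIntegral.integral_of_le hT]
    exact setIntegral_mono_set hgint ((ae_restrict_iff' measurableSet_Ioi).2
      (Eventually.of_forall hg0)) (Ioc_subset_Ioi_self.eventuallyLE)
  have hfle : ∫ x in (0 : ℝ)..T, |f x| ≤ ∫ x in Ioi 0, |f x| := by
    rw [intervalIntegral.integral_of_le hT]
    exact setIntegral_mono_set hfint.abs (Eventually.of_forall fun x => abs_nonneg _)
      (Ioc_subset_Ioi_self.eventuallyLE)
  have hpt : ∀ t ∈ Icc 0 T, |a t| ≤ |f t| + g t := by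
    intro t ht
    rw [heq t ht.1]
    refine (abs_add_le _ _).trans (add_le_add le_rfl ?_)
    refine (intervalIntegral.abs_integral_le_integral_abs ht.1).trans (le_of_eq ?_)
    refine intervalIntegral.integral_congr fun s hs => ?_
    rw [uIcc_of_le ht.1] at hs
    have h1 : s ∈ Iic T := hs.2.trans ht.2
    simp only [haT, indicator_of_mem h1, abs_mul, abs_of_pos (hKpos (t - s) (by linarith [hs.2]))]
    ring
  have hmono : ∫ x in (0 : ℝ)..T, |a x| ≤ ∫ x in (0 : ℝ)..T, (|f x| + g x) := by
    refine intervalIntegral.integral_mono_on hT (ha.abs.intervalIntegrable _ _) ?_ hpt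
    rw [intervalIntegrable_iff_integrableOn_Ioc_of_le hT]
    exact IntegrableOn.mono_set (hfint.abs.add hgint) Ioc_subset_Ioi_self
  rw [intervalIntegral.integral_add] at hmono
  · simp only [Real.norm_eq_abs]
    rw [le_div_iff₀ (by linarith)]
    have : ∫ x in Ioi 0, g x = (∫ x in (0 : ℝ)..T, |a x|) * I := by
      rw [← haTval, ← hval]
    nlinarith
  · rw [intervalIntegrable_iff_integrableOn_Ioc_of_le hT]
    exact IntegrableOn.mono_set hfint.abs Ioc_subset_Ioi_self
  · rw [intervalIntegrable_iff_integrableOn_Ioc_of_le hT]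
    exact hgint.mono_set Ioc_subset_Ioi_self

lemma integral_of_renewal
    (hKint : IntegrableOn K (Ioi 0)) (hI : ∫ t in Ioi 0, K t < 1)
    (hfint : IntegrableOn f (Ioi 0)) (haint : IntegrableOn a (Ioi 0))
    (heq : ∀ t, 0 ≤ t → a t = f t + ∫ s in (0 : ℝ)..t, K (t - s) * a s) :
    ∫ t in Ioi 0, a t = (∫ t in Ioi 0, f t) / (1 - ∫ t in Ioi 0, K t) := by
  have hconv := integrable_posConvolution (μ := volume) (ν := volume) haint hKint
    (ContinuousLinearMap.mul ℝ ℝ)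
  have hval := integral_posConvolution (μ := volume) (ν := volume) haint hKint
    (ContinuousLinearMap.mul ℝ ℝ)
  simp only [ContinuousLinearMap.mul_apply'] at hval
  have hgint : IntegrableOn (fun x => ∫ t in (0 : ℝ)..x, a t * K (x - t)) (Ioi 0) := by
    rw [← integrable_indicator_iff measurableSet_Ioi]
    simpa [posConvolution] using hconv
  have h1 : ∫ t in Ioi 0, a t = ∫ t in Ioi 0, (f t + ∫ s in (0 : ℝ)..t, a s * K (t - s)) := by
    refine setIntegral_congr_fun measurableSet_Ioi fun t ht => ?_
    simp only [mul_comm (a _)]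
    exact heq t (le_of_lt ht)
  rw [integral_add hfint hgint, hval] at h1
  rw [eq_div_iff (by linarith)]
  linarith

/-- Dominated convergence: for `s ≤ t / 2`, monotonicity and the doubling bound give `K (t - s) / K
t ≤ C`, and for fixed `s` this ratio tends to `1`. -/
lemma tendsto_integral_half_ratio {g : ℝ → ℝ} {C : ℝ} (hK : Continuous K)
    (hKpos : ∀ t, 0 ≤ t → 0 < K t) (hKanti : AntitoneOn K (Ici 0))
    (hlong : ∀ s, 0 ≤ s → Tendsto (fun t => K (t - s) / K t) atTop (𝓝 1))
    (hdbl : ∀ᶠ t in atTop, K (t / 2) ≤ C * K t) (hg : IntegrableOn g (Ioi 0)) :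
    Tendsto (fun t => ∫ s in (0 : ℝ)..(t / 2), g s * (K (t - s) / K t)) atTop
      (𝓝 (∫ s in Ioi 0, g s)) := by
  have hC : 0 ≤ C := by
    obtain ⟨t, ht, ht0⟩ := (hdbl.and (eventually_ge_atTop 0)).exists
    by_contra! hC
    nlinarith [hKpos t ht0, hKpos (t / 2) (by linarith)]
  have key : Tendsto (fun t => ∫ s in Ioi 0, indicator (Iic (t / 2))
      (fun s => g s * (K (t - s) / K t)) s) atTop (𝓝 (∫ s in Ioi 0, g s)) := by
    refine tendsto_integral_filter_of_dominated_convergence (fun s => |g s| * C) ?_ ?_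
      (hg.abs.mul_const C) ?_
    · refine Eventually.of_forall fun t => ?_
      refine AEStronglyMeasurable.indicator ?_ measurableSet_Iic
      exact hg.aestronglyMeasurable.mul
        ((hK.comp (continuous_const.sub continuous_id)).div_const _).aestronglyMeasurable
    · filter_upwards [hdbl, eventually_ge_atTop 0] with t ht ht0
      rw [ae_restrict_iff' measurableSet_Ioi]
      refine Eventually.of_forall fun s hs => ?_
      by_cases h : s ∈ Iic (t / 2)
      · rw [indicator_of_mem h, norm_mul, Real.norm_eq_abs, Real.norm_eq_abs]
        have h' : s ≤ t / 2 := h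
        have hs' : (0 : ℝ) < s := hs
        refine mul_le_mul_of_nonneg_left ?_ (abs_nonneg _)
        rw [abs_of_nonneg (div_nonneg (hKpos _ (by linarith)).le (hKpos _ ht0).le),
          div_le_iff₀ (hKpos _ ht0)]
        exact (hKanti (show (0 : ℝ) ≤ t / 2 by linarith) (show (0 : ℝ) ≤ t - s by linarith)
          (by linarith)).trans ht
      · rw [indicator_of_notMem h, norm_zero]
        positivity
    · rw [ae_restrict_iff' measurableSet_Ioi]
      refine Eventually.of_forall fun s hs => ?_
      have : Tendsto (fun t => g s * (K (t - s) / K t)) atTop (𝓝 (g s * 1)) :=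
        (hlong s (le_of_lt hs)).const_mul _
      rw [mul_one] at this
      refine this.congr' ?_
      filter_upwards [eventually_ge_atTop (2 * s)] with t ht
      rw [indicator_of_mem (show s ∈ Iic (t / 2) by simp; linarith)]
  refine key.congr' ?_
  filter_upwards [eventually_ge_atTop 0] with t ht
  rw [integral_indicator measurableSet_Iic, Measure.restrict_restrict measurableSet_Iic,
    intervalIntegral.integral_of_le (by linarith)]
  congr 2
  ext x; simp [and_comm]

/-- The convolution is cut at `t / 2` and its second half reflected, so that in each piece the
factor evaluated at `t - s` has argument at least `t / 2` and can be compared with `K t`. -/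
lemma renewal_split (hK : Continuous K) (hKpos : ∀ t, 0 ≤ t → 0 < K t) (ha : Continuous a)
    (heq : ∀ t, 0 ≤ t → a t = f t + ∫ s in (0 : ℝ)..t, K (t - s) * a s) {t : ℝ} (ht : 0 ≤ t) :
    a t / K t = f t / K t + (∫ s in (0 : ℝ)..(t / 2), a s * (K (t - s) / K t)) +
      ∫ s in (0 : ℝ)..(t / 2), K s * (K (t - s) / K t) * (a (t - s) / K (t - s)) := by
  have hc : Continuous fun s => K (t - s) * a s := by fun_prop
  have h1 : ∫ s in (0 : ℝ)..t, K (t - s) * a s = (∫ s in (0 : ℝ)..(t / 2), K (t - s) * a s) +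
      ∫ s in (0 : ℝ)..(t / 2), K s * a (t - s) := by
    rw [← intervalIntegral.integral_add_adjacent_intervals (hc.intervalIntegrable 0 (t / 2))
      (hc.intervalIntegrable (t / 2) t)]
    congr 1
    have := intervalIntegral.integral_comp_sub_left (a := 0) (b := t / 2)
      (fun s => K (t - s) * a s) t
    rw [show t - t / 2 = t / 2 by ring, sub_zero] at this
    rw [← this]
    simp
  rw [heq t ht, h1, add_div, add_div, ← intervalIntegral.integral_div,
    ← intervalIntegral.integral_div, ← add_assoc]
  congr 1
  · congr 1
    refine intervalIntegral.integral_congr fun s _ => ?_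
    ring_nf
  · refine intervalIntegral.integral_congr fun s hs => ?_
    rw [uIcc_of_le (by linarith)] at hs
    have h2 := (hKpos (t - s) (by linarith [hs.2])).ne'
    have h3 := (hKpos t ht).ne'
    field_simp

lemma abs_integral_half_le {w e : ℝ → ℝ} {S t : ℝ} (ht : 0 ≤ t)
    (hw : ContinuousOn w (Icc 0 (t / 2)))
    (hw0 : ∀ s ∈ Icc 0 (t / 2), 0 ≤ w s) (he : ContinuousOn e (Icc 0 (t / 2)))
    (heS : ∀ s ∈ Icc 0 (t / 2), |e s| ≤ S) :
    |∫ s in (0 : ℝ)..(t / 2), w s * e s| ≤ S * ∫ s in (0 : ℝ)..(t / 2), w s := by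
  have ht' : 0 ≤ t / 2 := by linarith
  refine (intervalIntegral.abs_integral_le_integral_abs ht').trans ?_
  rw [← intervalIntegral.integral_const_mul]
  refine intervalIntegral.integral_mono_on ht' ?_ ?_ fun s hs => ?_
  · exact ((hw.mul he).abs).intervalIntegrable_of_Icc ht'
  · exact (continuousOn_const.mul hw).intervalIntegrable_of_Icc ht'
  · rw [abs_mul, abs_of_nonneg (hw0 s hs), mul_comm]
    exact mul_le_mul_of_nonneg_right (heS s hs) (hw0 s hs)

/-- Solutions of a defective renewal equation with a subexponential kernel are asymptotically
proportional to the kernel. -/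
theorem tendsto_renewal_div_kernel {C ℓ : ℝ} (hK : Continuous K)
    (hKpos : ∀ t, 0 ≤ t → 0 < K t) (hKanti : AntitoneOn K (Ici 0))
    (hKint : IntegrableOn K (Ioi 0)) (hI : ∫ t in Ioi 0, K t < 1)
    (hlong : ∀ s, 0 ≤ s → Tendsto (fun t => K (t - s) / K t) atTop (𝓝 1))
    (hdbl : ∀ᶠ t in atTop, K (t / 2) ≤ C * K t)
    (hfint : IntegrableOn f (Ioi 0)) (hf : Tendsto (fun t => f t / K t) atTop (𝓝 ℓ))
    (ha : Continuous a)
    (heq : ∀ t, 0 ≤ t → a t = f t + ∫ s in (0 : ℝ)..t, K (t - s) * a s) :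
    Tendsto (fun t => a t / K t) atTop
      (𝓝 ((ℓ + (∫ t in Ioi 0, f t) / (1 - ∫ t in Ioi 0, K t)) / (1 - ∫ t in Ioi 0, K t))) := by
  have haint := integrableOn_of_renewal hKpos hKint hI hfint ha heq
  have hA := integral_of_renewal hKint hI hfint haint heq
  have hlimA := tendsto_integral_half_ratio hK hKpos hKanti hlong hdbl haint
  have hlimH := tendsto_integral_half_ratio hK hKpos hKanti hlong hdbl hKint
  rw [hA] at hlimA
  set I := ∫ t in Ioi 0, K t with hIdef
  set A := (∫ t in Ioi 0, f t) / (1 - I)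
  have hI0 : 0 ≤ I := setIntegral_nonneg measurableSet_Ioi fun t ht => (hKpos t (le_of_lt ht)).le
  set H : ℝ → ℝ := fun t => ∫ s in (0 : ℝ)..(t / 2), K s * (K (t - s) / K t) with hH
  set G : ℝ → ℝ := fun t => f t / K t + ∫ s in (0 : ℝ)..(t / 2), a s * (K (t - s) / K t) with hG
  have hlimG : Tendsto G atTop (𝓝 (ℓ + A)) := hf.add hlimA
  set q : ℝ → ℝ := fun t => a t / K t with hq
  have hqc : ContinuousOn q (Ici 0) := ha.continuousOn.div hK.continuousOn
    fun t ht => (hKpos t ht).ne'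
  have hsplit : ∀ t, 0 ≤ t → q t = G t +
      ∫ s in (0 : ℝ)..(t / 2), K s * (K (t - s) / K t) * q (t - s) :=
    fun t ht => renewal_split hK hKpos ha heq ht
  have hwc : ∀ t : ℝ, ContinuousOn (fun s => K s * (K (t - s) / K t)) (Icc 0 (t / 2)) :=
    fun t => by
      refine Continuous.continuousOn ?_
      exact hK.mul ((hK.comp (continuous_const.sub continuous_id)).div_const _)
  have hw0 : ∀ t : ℝ, 0 ≤ t → ∀ s ∈ Icc 0 (t / 2), 0 ≤ K s * (K (t - s) / K t) :=
    fun t ht s hs => mul_nonneg (hKpos s hs.1).le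
      (div_nonneg (hKpos _ (by linarith [hs.2])).le (hKpos t ht).le)
  have hqsc : ∀ t : ℝ, 0 ≤ t → ContinuousOn (fun s => q (t - s)) (Icc 0 (t / 2)) :=
    fun t ht => hqc.comp (continuous_const.sub continuous_id).continuousOn
      fun s hs => show (0 : ℝ) ≤ t - s by linarith [hs.2]
  -- Beyond some `T` one has `H ≤ I' < 1`. At a maximum `y ≥ T` of `|q|` on `[0, t]` this gives `|q
  -- y| ≤ |G y| + I' |q y|`, hence a bound on `q` independent of `t`.
  obtain ⟨I', hII', hI'1⟩ := exists_between hI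
  have hI'0 : 0 ≤ I' := hI0.trans hII'.le
  have hGbd : ∀ᶠ t in atTop, |G t| ≤ |ℓ + A| + 1 := by
    filter_upwards [hlimG.abs.eventually (eventually_lt_nhds (lt_add_one _))] with t ht using ht.le
  obtain ⟨T, hT⟩ := eventually_atTop.1 ((hlimH.eventually (eventually_lt_nhds hII')).and
    (hGbd.and (eventually_ge_atTop 0)))
  have hT0 : 0 ≤ T := (hT T le_rfl).2.2
  obtain ⟨x₀, -, hx₀⟩ := (isCompact_Icc (a := (0 : ℝ)) (b := T)).exists_isMaxOn
    ⟨0, left_mem_Icc.2 hT0⟩ ((hqc.mono Icc_subset_Ici_self).abs)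
  set B := max |q x₀| ((|ℓ + A| + 1) / (1 - I')) with hB
  have hbound : ∀ t, 0 ≤ t → |q t| ≤ B := by
    intro t ht
    obtain ⟨y, hy, hymax⟩ := (isCompact_Icc (a := (0 : ℝ)) (b := t)).exists_isMaxOn
      ⟨0, left_mem_Icc.2 ht⟩ ((hqc.mono Icc_subset_Ici_self).abs)
    refine (hymax (right_mem_Icc.2 ht)).trans ?_
    change |q y| ≤ B
    rcases le_total y T with hyT | hyT
    · exact (hx₀ ⟨hy.1, hyT⟩).trans (le_max_left _ _)
    · refine le_trans ?_ (le_max_right _ _)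
      rw [le_div_iff₀ (by linarith)]
      obtain ⟨h1, h2, -⟩ := hT y hyT
      have h3 := abs_integral_half_le hy.1 (hwc y) (hw0 y hy.1) (hqsc y hy.1) (S := |q y|)
        fun s hs => hymax ⟨by linarith [hs.2, hy.1], by linarith [hs.1, hy.2]⟩
      have h4 : |q y| ≤ |G y| + |q y| * H y := by
        conv_lhs => rw [hsplit y hy.1]
        exact (abs_add_le _ _).trans (add_le_add le_rfl h3)
      have h5 : |q y| * H y ≤ |q y| * I' := mul_le_mul_of_nonneg_left h1.le (abs_nonneg _)
      linarith
  -- The only candidate limit: the fixed point of the limiting equation `Q = ℓ + A + Q * I`.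
  set Q := (ℓ + A) / (1 - I) with hQ
  have hQeq : Q = ℓ + A + Q * I := by
    rw [hQ]; field_simp [show 1 - I ≠ 0 by linarith]; ring
  have herr : Tendsto (fun t => |G t - Q + Q * H t|) atTop (𝓝 0) := by
    have := ((hlimG.sub_const Q).add (hlimH.const_mul Q)).abs
    rwa [show ℓ + A - Q + Q * I = 0 by linarith, abs_zero] at this
  have hstepid : ∀ t, 0 ≤ t → q t - Q = (G t - Q + Q * H t) +
      ∫ s in (0 : ℝ)..(t / 2), K s * (K (t - s) / K t) * (q (t - s) - Q) := by
    intro t ht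
    have ht' : 0 ≤ t / 2 := by linarith
    simp only [mul_sub]
    rw [intervalIntegral.integral_sub, intervalIntegral.integral_mul_const, hsplit t ht]
    · change _ = _ + (_ - H t * Q); ring
    · exact ((hwc t).mul (hqsc t ht)).intervalIntegrable_of_Icc ht'
    · exact ((hwc t).mul continuousOn_const).intervalIntegrable_of_Icc ht'
  have hmain : Tendsto (fun t => |q t - Q|) atTop (𝓝 0) := by
    refine tendsto_zero_of_contracting (I := I) (B := B + |Q|) hI hI0 (fun t => abs_nonneg _) ?_ ?_
    · filter_upwards [eventually_ge_atTop 0] with t ht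
      exact (abs_sub _ _).trans (add_le_add (hbound t ht) le_rfl)
    · intro S hS ε hε
      have hSabs : ∀ᶠ t in atTop, |q t - Q| ≤ |S| := hS.mono fun t h => h.trans (le_abs_self _)
      have hS0 : 0 ≤ S := by
        obtain ⟨t, ht⟩ := hS.exists
        exact (abs_nonneg _).trans ht
      obtain ⟨T', hT'⟩ := eventually_atTop.1 hS
      have hlimHS : Tendsto (fun t => |G t - Q + Q * H t| + S * H t) atTop (𝓝 (0 + S * I)) :=
        herr.add (hlimH.const_mul S)
      filter_upwards [eventually_ge_atTop 0, eventually_ge_atTop (2 * T'),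
        hlimHS.eventually (eventually_lt_nhds (show 0 + S * I < I * S + ε by linarith))]
        with t ht htT hlt
      rw [hstepid t ht]
      refine (abs_add_le _ _).trans (le_trans (add_le_add le_rfl ?_) hlt.le)
      exact abs_integral_half_le ht (hwc t) (hw0 t ht) ((hqsc t ht).sub continuousOn_const)
        fun s hs => hT' _ (by linarith [hs.2])
  have := (tendsto_zero_iff_abs_tendsto_zero _).2 hmain
  simpa using this.add_const Q

end Renewal

/-! ### Abelian theorem for Laplace transforms at the edge -/

section Abel

variable {ν : Measure ℝ} [IsFiniteMeasure ν]

/-- Fubini applied to `e^{-θy} = ∫_{θy}^∞ e^{-z} dz`. -/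
lemma integral_exp_neg_eq_integral_Iic (hν : ∀ᵐ y ∂ν, 0 < y) {θ : ℝ} (hθ : 0 < θ) :
    ∫ y, Real.exp (-θ * y) ∂ν = ∫ z in Ioi (0 : ℝ), Real.exp (-z) * ν.real (Iic (z / θ)) := by
  set F : ℝ → ℝ → ℝ := fun y z => indicator {p : ℝ × ℝ | θ * p.1 ≤ p.2}
    (fun p => Real.exp (-p.2)) (y, z) with hF
  have hmeas : MeasurableSet {p : ℝ × ℝ | θ * p.1 ≤ p.2} :=
    measurableSet_le (by fun_prop) (by fun_prop)
  have hexp : IntegrableOn (fun z : ℝ => Real.exp (-z)) (Ioi 0) := integrableOn_exp_neg_Ioi 0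
  have hint : Integrable (Function.uncurry F) (ν.prod (volume.restrict (Ioi 0))) := by
    refine Integrable.mono' (g := fun p => Real.exp (-p.2)) (Integrable.comp_snd hexp ν) ?_ ?_
    · refine Measurable.aestronglyMeasurable ?_
      exact Measurable.indicator (by fun_prop) hmeas
    · refine Eventually.of_forall fun p => ?_
      change ‖indicator {p : ℝ × ℝ | θ * p.1 ≤ p.2} (fun p => Real.exp (-p.2)) p‖ ≤ _
      by_cases h : p ∈ {p : ℝ × ℝ | θ * p.1 ≤ p.2}
      · rw [indicator_of_mem h, Real.norm_of_nonneg (Real.exp_pos _).le]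
      · rw [indicator_of_notMem h, norm_zero]; positivity
  have hswap := integral_integral_swap hint
  have hl : ∫ y, (∫ z in Ioi 0, F y z) ∂ν = ∫ y, Real.exp (-θ * y) ∂ν := by
    refine integral_congr_ae ?_
    filter_upwards [hν] with y hy
    have : F y = indicator (Ici (θ * y)) (fun z => Real.exp (-z)) := by
      ext z; simp [hF, indicator]
    have hy' : 0 < θ * y := by positivity
    rw [this, integral_indicator measurableSet_Ici, Measure.restrict_restrict measurableSet_Ici,
      inter_eq_left.2 (show Ici (θ * y) ⊆ Ioi 0 from fun z hz => hy'.trans_le hz),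
      integral_Ici_eq_integral_Ioi,
      integral_exp_neg_Ioi, neg_mul]
  have hr : ∀ z : ℝ, ∫ y, F y z ∂ν = Real.exp (-z) * ν.real (Iic (z / θ)) := by
    intro z
    have : (fun y => F y z) = indicator (Iic (z / θ)) (fun _ => Real.exp (-z)) := by
      ext y; simp [hF, indicator, le_div_iff₀ hθ, mul_comm]
    rw [this, integral_indicator measurableSet_Iic, setIntegral_const, smul_eq_mul, mul_comm]
  rw [← hl, hswap]
  simp only [hr]

/-- A Potter-type bound: doubling is iterated while the scale stays below `s₀`; past it the total
mass is compared with the mass at `s₀`, which only costs the factor `max 1 _`. -/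
lemma measureReal_Iic_two_pow_mul_le {D s₀ : ℝ} (hpos : ∀ s, 0 < s → 0 < ν.real (Iic s))
    (hs₀ : 0 < s₀) (hD : 1 ≤ D)
    (hdbl : ∀ s, 0 < s → s ≤ s₀ → ν.real (Iic (2 * s)) ≤ D * ν.real (Iic s)) (k : ℕ) :
    ∀ s, 0 < s → s ≤ s₀ →
    ν.real (Iic (2 ^ k * s)) ≤ max 1 (ν.real univ / ν.real (Iic s₀)) * D ^ k * ν.real (Iic s) := by
  set C := max 1 (ν.real univ / ν.real (Iic s₀)) with hC
  have hC1 : 1 ≤ C := le_max_left _ _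
  induction k with
  | zero =>
    intro s hs _
    simp only [pow_zero, one_mul, mul_one]
    exact le_mul_of_one_le_left (hpos s hs).le hC1
  | succ k ih =>
    intro s hs hss
    have hDk : 0 ≤ C * D ^ k := by positivity
    rcases le_or_gt (2 * s) s₀ with h | h
    · have h1 := ih (2 * s) (by linarith) h
      have h2 := mul_le_mul_of_nonneg_left (hdbl s hs hss) hDk
      rw [show (2 : ℝ) ^ (k + 1) * s = 2 ^ k * (2 * s) by ring]
      rw [pow_succ]
      linarith
    · have h1 : ν.real (Iic (2 ^ (k + 1) * s)) ≤ ν.real univ := measureReal_mono (subset_univ _)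
      have h2 : ν.real univ ≤ C * ν.real (Iic s₀) := by
        rw [← div_le_iff₀ (hpos s₀ hs₀)]; exact le_max_right _ _
      have h3 : ν.real (Iic s₀) ≤ D * ν.real (Iic s) :=
        (measureReal_mono (Iic_subset_Iic.2 h.le)).trans (hdbl s hs hss)
      have h4 : D ≤ D ^ (k + 1) := le_self_pow₀ hD (by simp)
      have h5 : D * ν.real (Iic s) ≤ D ^ (k + 1) * ν.real (Iic s) :=
        mul_le_mul_of_nonneg_right h4 (hpos s hs).le
      have h6 : C * ν.real (Iic s₀) ≤ C * (D ^ (k + 1) * ν.real (Iic s)) :=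
        mul_le_mul_of_nonneg_left (h3.trans h5) (by linarith)
      rw [mul_assoc]
      linarith

/-- Abelian theorem for the Laplace transform of a measure that is regularly varying at `0`. -/
theorem tendsto_integral_exp_div {α : ℝ} (hα : 0 < α) (hν : ∀ᵐ y ∂ν, 0 < y)
    (hpos : ∀ s, 0 < s → 0 < ν.real (Iic s))
    (hrv : ∀ c, 0 < c → Tendsto (fun θ : ℝ => ν.real (Iic (c / θ)) / ν.real (Iic (1 / θ))) atTop
      (𝓝 (c ^ α))) :
    Tendsto (fun θ : ℝ => (∫ y, Real.exp (-θ * y) ∂ν) / ν.real (Iic (1 / θ))) atTop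
      (𝓝 (Real.Gamma (α + 1))) := by
  -- The limiting doubling ratio `2 ^ α` is below `2 ^ n`, so `D = 2 ^ n` works at small scales and
  -- yields the dominating function `1 + C D z ^ n`, integrable against `e^{-z}`.
  obtain ⟨n, hn⟩ := exists_nat_gt α
  set D : ℝ := 2 ^ n with hD
  have hD1 : 1 ≤ D := one_le_pow₀ (by norm_num)
  have h2α : (2 : ℝ) ^ α < D := by
    rw [hD, ← Real.rpow_natCast]
    exact Real.rpow_lt_rpow_of_exponent_lt (by norm_num) hn
  obtain ⟨θ₀, hθ₀⟩ := eventually_atTop.1 (((hrv 2 (by norm_num)).eventually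
    (eventually_lt_nhds h2α)).and (eventually_gt_atTop 0))
  have hθ₀pos : 0 < θ₀ := (hθ₀ θ₀ le_rfl).2
  have hdbl : ∀ s, 0 < s → s ≤ 1 / θ₀ → ν.real (Iic (2 * s)) ≤ D * ν.real (Iic s) := by
    intro s hs hs'
    have := (hθ₀ (1 / s) (by rwa [le_div_iff₀ hs, mul_comm, ← le_div_iff₀ hθ₀pos])).1
    rw [one_div_one_div, div_div_eq_mul_div, div_one, div_lt_iff₀ (hpos s hs)] at this
    exact this.le
  have hpow := measureReal_Iic_two_pow_mul_le hpos (by positivity) hD1 hdbl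
  set C := max 1 (ν.real univ / ν.real (Iic (1 / θ₀)))
  have hC1 : 1 ≤ C := le_max_left _ _
  have hbd : ∀ z θ : ℝ, 0 < z → θ₀ ≤ θ →
      ν.real (Iic (z / θ)) / ν.real (Iic (1 / θ)) ≤ 1 + C * D * z ^ n := by
    intro z θ hz hθ
    have hθpos : 0 < θ := hθ₀pos.trans_le hθ
    have hU := hpos (1 / θ) (by positivity)
    rw [div_le_iff₀ hU]
    rcases le_total z 1 with h1 | h1
    · have h2 : ν.real (Iic (z / θ)) ≤ ν.real (Iic (1 / θ)) :=
        measureReal_mono (Iic_subset_Iic.2 (by gcongr))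
      have : 0 ≤ C * D * z ^ n * ν.real (Iic (1 / θ)) := by positivity
      linarith
    · obtain ⟨k, hk, hk'⟩ := exists_nat_pow_near h1 (by norm_num : (1 : ℝ) < 2)
      have h2 : ν.real (Iic (z / θ)) ≤ ν.real (Iic (2 ^ (k + 1) * (1 / θ))) :=
        measureReal_mono (Iic_subset_Iic.2 (by
          rw [div_eq_mul_one_div]; gcongr))
      have h3 := hpow (k + 1) (1 / θ) (by positivity) (by gcongr)
      have h4 : D ^ k ≤ z ^ n := by
        rw [hD, ← pow_mul, mul_comm, pow_mul]
        gcongr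
      have h5 : C * D ^ (k + 1) ≤ C * D * z ^ n := by
        rw [pow_succ]
        nlinarith [mul_le_mul_of_nonneg_left h4 (by positivity : 0 ≤ C * D)]
      nlinarith [mul_le_mul_of_nonneg_right h5 hU.le]
  have hgam : ∀ s : ℝ, 0 ≤ s → IntegrableOn (fun z : ℝ => Real.exp (-z) * z ^ s) (Ioi 0) := by
    intro s hs
    simpa using Real.GammaIntegral_convergent (s := s + 1) (by linarith)
  have hlim : Tendsto (fun θ : ℝ => ∫ z in Ioi (0 : ℝ),
      Real.exp (-z) * (ν.real (Iic (z / θ)) / ν.real (Iic (1 / θ)))) atTop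
      (𝓝 (∫ z in Ioi (0 : ℝ), Real.exp (-z) * z ^ α)) := by
    refine tendsto_integral_filter_of_dominated_convergence
      (fun z => Real.exp (-z) * z ^ (0 : ℝ) + C * D * (Real.exp (-z) * z ^ (n : ℝ))) ?_ ?_ ?_ ?_
    · filter_upwards [eventually_gt_atTop 0] with θ hθ
      refine Measurable.aestronglyMeasurable ?_
      have hmono : Monotone fun z : ℝ => ν.real (Iic (z / θ)) := fun a b hab =>
        measureReal_mono (Iic_subset_Iic.2 (by gcongr))
      exact (by fun_prop : Measurable fun z : ℝ => Real.exp (-z)).mul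
        (hmono.measurable.div_const _)
    · filter_upwards [eventually_ge_atTop θ₀] with θ hθ
      rw [ae_restrict_iff' measurableSet_Ioi]
      refine Eventually.of_forall fun z hz => ?_
      rw [Real.norm_of_nonneg (by positivity), Real.rpow_zero, Real.rpow_natCast]
      have := mul_le_mul_of_nonneg_left (hbd z θ hz hθ) (Real.exp_pos (-z)).le
      linarith
    · exact (hgam 0 le_rfl).add ((hgam n (by positivity)).const_mul _)
    · rw [ae_restrict_iff' measurableSet_Ioi]
      exact Eventually.of_forall fun z hz => (hrv z hz).const_mul _
  have hG : ∫ z in Ioi (0 : ℝ), Real.exp (-z) * z ^ α = Real.Gamma (α + 1) := by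
    rw [Real.Gamma_eq_integral (by linarith)]; simp
  rw [hG] at hlim
  refine hlim.congr' ?_
  filter_upwards [eventually_gt_atTop 0] with θ hθ
  rw [integral_exp_neg_eq_integral_Iic hν hθ, ← integral_div]
  simp only [mul_div_assoc]

/-- From `y e^{-θy} ≤ (2/θ) e^{-θy/2}`: halving `θ` changes the normalising mass by a bounded
factor, so the extra `1/θ` sends the ratio to zero. -/
lemma tendsto_integral_mul_exp_div {α C : ℝ} {g : ℝ → ℝ} (hα : 0 < α) (hν : ∀ᵐ y ∂ν, 0 < y)
    (hpos : ∀ s, 0 < s → 0 < ν.real (Iic s))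
    (hrv : ∀ c, 0 < c → Tendsto (fun θ : ℝ => ν.real (Iic (c / θ)) / ν.real (Iic (1 / θ))) atTop
      (𝓝 (c ^ α))) (hg : ∀ᵐ y ∂ν, |g y| ≤ C * y) :
    Tendsto (fun θ : ℝ => (∫ y, g y * Real.exp (-θ * y) ∂ν) / ν.real (Iic (1 / θ))) atTop
      (𝓝 0) := by
  have h1 := tendsto_integral_exp_div hα hν hpos hrv
  have h2 : Tendsto (fun θ : ℝ => |C| * (2 / θ) *
      (((∫ y, Real.exp (-(θ / 2) * y) ∂ν) / ν.real (Iic (1 / (θ / 2)))) *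
        (ν.real (Iic (2 / θ)) / ν.real (Iic (1 / θ))))) atTop
      (𝓝 (|C| * 0 * (Real.Gamma (α + 1) * 2 ^ α))) := by
    refine Tendsto.mul (Tendsto.const_mul _ (tendsto_id.const_div_atTop 2))
      (Tendsto.mul ?_ (hrv 2 (by norm_num)))
    exact h1.comp (tendsto_id.atTop_div_const (by norm_num))
  rw [mul_zero, zero_mul] at h2
  refine squeeze_zero_norm' ?_ h2
  filter_upwards [eventually_gt_atTop 0] with θ hθ
  have hU := hpos (1 / θ) (by positivity)
  have hU2 := hpos (2 / θ) (by positivity)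
  have hint : Integrable (fun y => Real.exp (-(θ / 2) * y)) ν := by
    refine Integrable.mono' (integrable_const (1 : ℝ)) (by fun_prop) ?_
    filter_upwards [hν] with y hy
    rw [Real.norm_of_nonneg (Real.exp_pos _).le, Real.exp_le_one_iff]
    nlinarith
  have hle : ‖∫ y, g y * Real.exp (-θ * y) ∂ν‖ ≤
      ∫ y, |C| * (2 / θ) * Real.exp (-(θ / 2) * y) ∂ν := by
    refine norm_integral_le_of_norm_le (hint.const_mul _) ?_
    filter_upwards [hν, hg] with y hy hgy
    have e1 : θ / 2 * y ≤ Real.exp (θ / 2 * y) := by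
      linarith [Real.add_one_le_exp (θ / 2 * y)]
    have e2 : y ≤ 2 / θ * Real.exp (θ / 2 * y) := by
      rw [div_mul_eq_mul_div, le_div_iff₀ hθ]; linarith
    have e3 : Real.exp (-(θ / 2) * y) = Real.exp (θ / 2 * y) * Real.exp (-θ * y) := by
      rw [← Real.exp_add]; ring_nf
    rw [norm_mul, Real.norm_of_nonneg (Real.exp_pos _).le, e3, Real.norm_eq_abs]
    have e4 : |g y| ≤ |C| * (2 / θ * Real.exp (θ / 2 * y)) :=
      hgy.trans ((mul_le_mul_of_nonneg_right (le_abs_self C) hy.le).trans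
        (mul_le_mul_of_nonneg_left e2 (abs_nonneg C)))
    calc |g y| * Real.exp (-θ * y)
        ≤ |C| * (2 / θ * Real.exp (θ / 2 * y)) * Real.exp (-θ * y) := by gcongr
      _ = _ := by ring
  rw [integral_const_mul] at hle
  rw [norm_div, Real.norm_of_nonneg hU.le, div_le_iff₀ hU]
  refine hle.trans (le_of_eq ?_)
  rw [one_div_div]
  field_simp

end Abel

/-! ### Spectral gap and exact exponential asymptotics -/

section Energy

variable {ν : Measure ℝ} [IsFiniteMeasure ν] {e M : ℝ}

lemma integrable_of_continuousOn (hν : ∀ᵐ x ∂ν, x ∈ Icc e M) {f : ℝ → ℝ}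
    (hf : ContinuousOn f (Icc e M)) : Integrable f ν := by
  rw [← Measure.restrict_eq_self_of_ae_mem hν]
  exact hf.integrableOn_compact isCompact_Icc

lemma hasDerivAt_integral_of_continuousOn (hν : ∀ᵐ x ∂ν, x ∈ Icc e M) {u u' : ℝ → ℝ → ℝ}
    (hu : ContinuousOn (Function.uncurry u) (univ ×ˢ Icc e M))
    (hu' : ContinuousOn (Function.uncurry u') (univ ×ˢ Icc e M))
    (hd : ∀ t, ∀ x ∈ Icc e M, HasDerivAt (fun t => u t x) (u' t x) t) (t : ℝ) :
    HasDerivAt (fun t => ∫ x, u t x ∂ν) (∫ x, u' t x ∂ν) t := by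
  have hslice : ∀ {w : ℝ → ℝ → ℝ}, ContinuousOn (Function.uncurry w) (univ ×ˢ Icc e M) →
      ∀ t, Integrable (w t) ν := fun {w} hw t =>
    integrable_of_continuousOn hν (hw.comp (f := fun x => (t, x)) (by fun_prop)
      fun x hx => ⟨mem_univ _, hx⟩)
  obtain ⟨C, hC⟩ := ((isCompact_Icc (a := t - 1) (b := t + 1)).prod
    (isCompact_Icc (a := e) (b := M))).exists_bound_of_continuousOn
    (hu'.mono (prod_mono (subset_univ _) le_rfl))
  refine (hasDerivAt_integral_of_dominated_loc_of_deriv_le (bound := fun _ => C)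
    (Icc_mem_nhds (by linarith : t - 1 < t) (by linarith : t < t + 1))
    (Eventually.of_forall fun s => (hslice hu s).aestronglyMeasurable) (hslice hu t)
    (hslice hu' t).aestronglyMeasurable ?_ (integrable_const _) ?_).2
  · filter_upwards [hν] with x hx s hs using hC (s, x) ⟨hs, hx⟩
  · filter_upwards [hν] with x hx s _ using hd s x hx

/-- Expand the nonnegative integral of `(u + s x²/(x-λ))² (x-e)/x²`. The orthogonality `hy` kills
one cross term, and writing `x - e = (x - λ) - (e - λ)` shows that what is left over has the
favourable sign. -/
lemma spectral_gap_inequality (hν : ∀ᵐ x ∂ν, x ∈ Icc e M) (he : 0 < e) {g b lam : ℝ}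
    (hg : 0 < g) (hb : 0 < b) (hlam : lam < e) (hF : ∫ x, x ^ 2 / (x - lam) ∂ν = g / b)
    {u : ℝ → ℝ} (hu : ContinuousOn u (Icc e M)) (hy : ∫ x, u x / (x - lam) ∂ν = 0) :
    b / g * (∫ x, u x ∂ν) ^ 2 ≤ ∫ x, u x ^ 2 * (x - e) / x ^ 2 ∂ν := by
  have hx0 : ∀ x ∈ Icc e M, x ≠ 0 := fun x hx => (he.trans_le hx.1).ne'
  have hxl : ∀ x ∈ Icc e M, x - lam ≠ 0 := fun x hx => (sub_pos.2 (hlam.trans_le hx.1)).ne'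
  have hx02 : ∀ x ∈ Icc e M, x ^ 2 ≠ 0 := fun x hx => pow_ne_zero _ (hx0 x hx)
  have hxl2 : ∀ x ∈ Icc e M, (x - lam) ^ 2 ≠ 0 := fun x hx => pow_ne_zero _ (hxl x hx)
  have hi := fun {f : ℝ → ℝ} (hf : ContinuousOn f (Icc e M)) => integrable_of_continuousOn hν hf
  set Φ := ∫ x, u x ∂ν with hΦ
  -- The minimiser of `2sΦ + s² g/b`, with minimum `-(b/g) Φ²`.
  set s := -(b / g) * Φ with hs
  have i1 : Integrable (fun x => u x ^ 2 * (x - e) / x ^ 2) ν := hi (by fun_prop (disch := assumption))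
  have i2 : Integrable u ν := hi hu
  have i3 : Integrable (fun x => u x / (x - lam)) ν := hi (by fun_prop (disch := assumption))
  have i4 : Integrable (fun x => x ^ 2 / (x - lam)) ν := hi (by fun_prop (disch := assumption))
  have i5 : Integrable (fun x => x ^ 2 / (x - lam) ^ 2) ν := hi (by fun_prop (disch := assumption))
  have h0 : 0 ≤ ∫ x, (u x + s * (x ^ 2 / (x - lam))) ^ 2 * (x - e) / x ^ 2 ∂ν := by
    refine integral_nonneg_of_ae ?_
    filter_upwards [hν] with x hx
    have : 0 ≤ x - e := sub_nonneg.2 hx.1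
    exact div_nonneg (mul_nonneg (sq_nonneg _) this) (sq_nonneg _)
  have h5 : 0 ≤ ∫ x, x ^ 2 / (x - lam) ^ 2 ∂ν := integral_nonneg fun x => by positivity
  have hexp : ∫ x, (u x + s * (x ^ 2 / (x - lam))) ^ 2 * (x - e) / x ^ 2 ∂ν =
      ∫ x, (u x ^ 2 * (x - e) / x ^ 2 + (2 * s) * u x + (2 * s * (lam - e)) * (u x / (x - lam)) +
        s ^ 2 * (x ^ 2 / (x - lam)) + (s ^ 2 * (lam - e)) * (x ^ 2 / (x - lam) ^ 2)) ∂ν := by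
    refine integral_congr_ae ?_
    filter_upwards [hν] with x hx
    have h1 := hx0 x hx
    have h2 := hxl x hx
    field_simp
    ring
  rw [integral_add (by fun_prop) (by fun_prop), integral_add (by fun_prop) (by fun_prop),
    integral_add (by fun_prop) (by fun_prop), integral_add (by fun_prop) (by fun_prop),
    integral_const_mul, integral_const_mul, integral_const_mul, integral_const_mul, hy, hF,
    ← hΦ] at hexp
  have h6 : s ^ 2 * (lam - e) * ∫ x, x ^ 2 / (x - lam) ^ 2 ∂ν ≤ 0 :=
    mul_nonpos_of_nonpos_of_nonneg
      (mul_nonpos_of_nonneg_of_nonpos (sq_nonneg _) (by linarith)) h5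
  have h7 : 2 * s * Φ + s ^ 2 * (g / b) = -(b / g * Φ ^ 2) := by
    rw [hs]; field_simp; ring
  linarith

/-- Exponential decay of the component orthogonal to the ground state. -/
lemma sq_le_of_orthogonal_flow (hν : ∀ᵐ x ∂ν, x ∈ Icc e M) (he : 0 < e) {g b lam : ℝ}
    (hg : 0 < g) (hb : 0 < b) (hlam : lam < e) (hF : ∫ x, x ^ 2 / (x - lam) ∂ν = g / b)
    {u : ℝ → ℝ → ℝ} {Φ : ℝ → ℝ} (hΦc : Continuous Φ)
    (hu : ContinuousOn (Function.uncurry u) (univ ×ˢ Icc e M))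
    (hd : ∀ t, ∀ x ∈ Icc e M,
      HasDerivAt (fun t => u t x) (-g * x * u t x + b * x ^ 2 * Φ t) t)
    (hΦ : ∀ t, 0 ≤ t → Φ t = ∫ x, u t x ∂ν) (hy : ∫ x, u 0 x / (x - lam) ∂ν = 0) :
    ∃ C, ∀ t, 0 ≤ t → Φ t ^ 2 ≤ C * Real.exp (-(2 * g * e) * t) := by
  have hx0 : ∀ x ∈ Icc e M, x ≠ 0 := fun x hx => (he.trans_le hx.1).ne'
  have hxl : ∀ x ∈ Icc e M, x - lam ≠ 0 := fun x hx => (sub_pos.2 (hlam.trans_le hx.1)).ne'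
  have hx02 : ∀ x ∈ Icc e M, x ^ 2 ≠ 0 := fun x hx => pow_ne_zero _ (hx0 x hx)
  have pxl : ∀ p ∈ (univ ×ˢ Icc e M : Set (ℝ × ℝ)), p.2 - lam ≠ 0 := fun p hp => hxl _ hp.2
  have px2 : ∀ p ∈ (univ ×ˢ Icc e M : Set (ℝ × ℝ)), p.2 ^ 2 ≠ 0 := fun p hp => hx02 _ hp.2
  have hi := fun {f : ℝ → ℝ} (hf : ContinuousOn f (Icc e M)) => integrable_of_continuousOn hν hf
  have hu1 : ContinuousOn (fun p : ℝ × ℝ => u p.1 p.2) (univ ×ˢ Icc e M) := hu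
  have hus : ∀ t, ContinuousOn (u t) (Icc e M) := fun t =>
    hu.comp (f := fun x => (t, x)) (by fun_prop) fun x hx => ⟨mem_univ _, hx⟩
  -- the component along the ground state vanishes
  have hyd := hasDerivAt_integral_of_continuousOn hν (u := fun t x => u t x / (x - lam))
    (u' := fun t x => (-g * x * u t x + b * x ^ 2 * Φ t) / (x - lam))
    (by simp only [Function.uncurry_def]; fun_prop (disch := assumption))
    (by simp only [Function.uncurry_def]; fun_prop (disch := assumption))
    (fun t x hx => (hd t x hx).div_const _)
  -- The pairing of `u t` with the ground state `x²/(x-λ)` in `L²(x⁻² ν)` is `∫ u/(x-λ)`; symmetry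
  -- of the generator makes it an eigenfunctional with eigenvalue `-gλ`.
  have hyval : ∀ t, 0 ≤ t → ∫ x, (-g * x * u t x + b * x ^ 2 * Φ t) / (x - lam) ∂ν =
      -(g * lam) * ∫ x, u t x / (x - lam) ∂ν := by
    intro t ht
    have hut := hus t
    have i2 : Integrable (u t) ν := hi hut
    have i3 : Integrable (fun x => u t x / (x - lam)) ν := hi (by fun_prop (disch := assumption))
    have i4 : Integrable (fun x => x ^ 2 / (x - lam)) ν := hi (by fun_prop (disch := assumption))
    have : ∫ x, (-g * x * u t x + b * x ^ 2 * Φ t) / (x - lam) ∂ν =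
        ∫ x, ((-g) * u t x + (-(g * lam)) * (u t x / (x - lam)) +
          (b * Φ t) * (x ^ 2 / (x - lam))) ∂ν := by
      refine integral_congr_ae ?_
      filter_upwards [hν] with x hx
      have h2 := hxl x hx
      field_simp
      ring
    rw [this, integral_add (by fun_prop) (by fun_prop), integral_add (by fun_prop) (by fun_prop),
      integral_const_mul, integral_const_mul, integral_const_mul, hF, ← hΦ t ht]
    field_simp
    ring
  have hyzero : ∀ t, 0 ≤ t → ∫ x, u t x / (x - lam) ∂ν = 0 := by
    intro t ht
    have hder : ∀ s, 0 ≤ s → HasDerivAt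
        (fun s => Real.exp (g * lam * s) * ∫ x, u s x / (x - lam) ∂ν) 0 s := by
      intro s hs
      have h1 : HasDerivAt (fun s => Real.exp (g * lam * s))
          (Real.exp (g * lam * s) * (g * lam)) s := by
        simpa using ((hasDerivAt_id s).const_mul (g * lam)).exp
      refine (h1.mul (hyd s)).congr_deriv ?_
      rw [hyval s hs]; ring
    have := constant_of_has_deriv_right_zero (a := 0) (b := t)
      (fun s hs => (hder s hs.1).continuousAt.continuousWithinAt)
      (fun s hs => (hder s hs.1).hasDerivWithinAt) t (right_mem_Icc.2 ht)
    simpa [hy, (Real.exp_pos _).ne'] using this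
  have hEd := hasDerivAt_integral_of_continuousOn hν (u := fun t x => u t x ^ 2 / x ^ 2)
    (u' := fun t x => 2 * u t x * (-g * x * u t x + b * x ^ 2 * Φ t) / x ^ 2)
    (by simp only [Function.uncurry_def]; fun_prop (disch := assumption))
    (by simp only [Function.uncurry_def]; fun_prop (disch := assumption))
    (fun t x hx => by
      have := ((hd t x hx).pow 2).div_const (x ^ 2)
      simpa using this)
  -- The squared norm for which the generator is symmetric; the gap inequality becomes `E' ≤ -2ge
  -- E`.
  set E : ℝ → ℝ := fun t => ∫ x, u t x ^ 2 / x ^ 2 ∂ν with hE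
  have hgap : ∀ t, 0 ≤ t → b / g * Φ t ^ 2 ≤ ∫ x, u t x ^ 2 * (x - e) / x ^ 2 ∂ν := by
    intro t ht
    rw [hΦ t ht]
    exact spectral_gap_inequality hν he hg hb hlam hF (hus t) (hyzero t ht)
  have hEval : ∀ t, 0 ≤ t → ∫ x, 2 * u t x * (-g * x * u t x + b * x ^ 2 * Φ t) / x ^ 2 ∂ν ≤
      -(2 * g * e) * E t := by
    intro t ht
    have hut := hus t
    have i1 : Integrable (fun x => u t x ^ 2 * (x - e) / x ^ 2) ν :=
      hi (by fun_prop (disch := assumption))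
    have i2 : Integrable (u t) ν := hi hut
    have i3 : Integrable (fun x => u t x ^ 2 / x ^ 2) ν := hi (by fun_prop (disch := assumption))
    have : ∫ x, 2 * u t x * (-g * x * u t x + b * x ^ 2 * Φ t) / x ^ 2 ∂ν =
        ∫ x, ((-(2 * g)) * (u t x ^ 2 * (x - e) / x ^ 2) + (-(2 * g * e)) * (u t x ^ 2 / x ^ 2) +
          (2 * b * Φ t) * u t x) ∂ν := by
      refine integral_congr_ae ?_
      filter_upwards [hν] with x hx
      have h2 := hx0 x hx
      field_simp
      ring
    rw [this, integral_add (by fun_prop) (by fun_prop), integral_add (by fun_prop) (by fun_prop),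
      integral_const_mul, integral_const_mul, integral_const_mul, ← hΦ t ht]
    have h1 := mul_le_mul_of_nonneg_left (hgap t ht) (by positivity : 0 ≤ 2 * g)
    have h2 : 2 * g * (b / g * Φ t ^ 2) = 2 * b * Φ t * Φ t := by field_simp
    change _ + -(2 * g * e) * E t + _ ≤ _
    linarith
  have hanti : AntitoneOn (fun t => Real.exp (2 * g * e * t) * E t) (Ici 0) := by
    have hder : ∀ s, HasDerivAt (fun s => Real.exp (2 * g * e * s) * E s)
        (Real.exp (2 * g * e * s) * (2 * g * e) * E s + Real.exp (2 * g * e * s) *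
          ∫ x, 2 * u s x * (-g * x * u s x + b * x ^ 2 * Φ s) / x ^ 2 ∂ν) s := by
      intro s
      have h1 : HasDerivAt (fun s => Real.exp (2 * g * e * s))
          (Real.exp (2 * g * e * s) * (2 * g * e)) s := by
        simpa using ((hasDerivAt_id s).const_mul (2 * g * e)).exp
      exact h1.mul (hEd s)
    refine antitoneOn_of_deriv_nonpos (convex_Ici 0)
      (fun s _ => (hder s).continuousAt.continuousWithinAt)
      (fun s _ => (hder s).differentiableAt.differentiableWithinAt) fun s hs => ?_
    rw [interior_Ici] at hs
    rw [(hder s).deriv]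
    have := mul_le_mul_of_nonneg_left (hEval s (le_of_lt hs)) (Real.exp_pos (2 * g * e * s)).le
    linarith
  refine ⟨g / b * M * E 0, fun t ht => ?_⟩
  have hEt : E t ≤ E 0 * Real.exp (-(2 * g * e) * t) := by
    have := hanti self_mem_Ici ht ht
    simp only [mul_zero, Real.exp_zero, one_mul] at this
    rw [neg_mul, Real.exp_neg, ← div_eq_mul_inv, le_div_iff₀ (Real.exp_pos _)]
    linarith
  have hut := hus t
  have h1 : ∫ x, u t x ^ 2 * (x - e) / x ^ 2 ∂ν ≤ ∫ x, M * (u t x ^ 2 / x ^ 2) ∂ν := by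
    refine integral_mono_ae (hi (by fun_prop (disch := assumption)))
      (hi (by fun_prop (disch := assumption))) ?_
    filter_upwards [hν] with x hx
    have h3 : 0 ≤ u t x ^ 2 / x ^ 2 := by positivity
    have h4 := mul_le_mul_of_nonneg_right (show x - e ≤ M by linarith [hx.2]) h3
    calc _ = (x - e) * (u t x ^ 2 / x ^ 2) := by ring
      _ ≤ _ := h4
  rw [integral_const_mul] at h1
  by_cases hM : 0 ≤ M
  · have h2 : b / g * Φ t ^ 2 ≤ M * (E 0 * Real.exp (-(2 * g * e) * t)) :=
      (hgap t ht).trans (h1.trans (mul_le_mul_of_nonneg_left hEt hM))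
    have h3 := mul_le_mul_of_nonneg_left h2 (by positivity : 0 ≤ g / b)
    have h4 : g / b * (b / g * Φ t ^ 2) = Φ t ^ 2 := by field_simp
    rw [h4] at h3
    linarith
  -- Here `M < 0 < e`, so `Icc e M` is empty.
  · have hν0 : ν = 0 := by
      rw [← ae_eq_bot]
      refine empty_mem_iff_bot.1 ?_
      filter_upwards [hν] with x hx
      linarith [hx.1, hx.2]
    have h2 := hΦ t ht
    simp [hν0] at h2
    simp [h2, hE, hν0]

/-- Exact exponential asymptotics of a renewal equation whose kernel is a mixture of
exponentials, in the presence of an isolated Malthusian exponent. -/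
theorem tendsto_exp_mul_of_malthusian (hν : ∀ᵐ x ∂ν, x ∈ Icc e M) (he : 0 < e) {g b lam : ℝ}
    (hg : 0 < g) (hb : 0 < b) (hlam : lam < e) (hF : ∫ x, x ^ 2 / (x - lam) ∂ν = g / b)
    {p φ : ℝ → ℝ} (hp : Continuous p) (hφ : Continuous φ)
    (heq : ∀ t, 0 ≤ t → φ t = ∫ x, p x * Real.exp (-g * t * x) ∂ν +
      ∫ s in (0 : ℝ)..t, b * (∫ x, x ^ 2 * Real.exp (-g * (t - s) * x) ∂ν) * φ s) :
    Tendsto (fun t => Real.exp (g * lam * t) * φ t) atTop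
      (𝓝 (g / b * ((∫ x, p x / (x - lam) ∂ν) / ∫ x, x ^ 2 / (x - lam) ^ 2 ∂ν))) := by
  have hx0 : ∀ x ∈ Icc e M, x ≠ 0 := fun x hx => (he.trans_le hx.1).ne'
  have hxl : ∀ x ∈ Icc e M, x - lam ≠ 0 := fun x hx => (sub_pos.2 (hlam.trans_le hx.1)).ne'
  have hxl2 : ∀ x ∈ Icc e M, (x - lam) ^ 2 ≠ 0 := fun x hx => pow_ne_zero _ (hxl x hx)
  have pxl : ∀ p ∈ (univ ×ˢ Icc e M : Set (ℝ × ℝ)), p.2 - lam ≠ 0 := fun p hp => hxl _ hp.2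
  have hi := fun {f : ℝ → ℝ} (hf : ContinuousOn f (Icc e M)) => integrable_of_continuousOn hν hf
  have i4 : Integrable (fun x => x ^ 2 / (x - lam)) ν := hi (by fun_prop (disch := assumption))
  have i5 : Integrable (fun x => x ^ 2 / (x - lam) ^ 2) ν := hi (by fun_prop (disch := assumption))
  have hpos : 0 < ∫ x, x ^ 2 / (x - lam) ^ 2 ∂ν := by
    have h0 : 0 ≤ᵐ[ν] fun x => x ^ 2 / (x - lam) ^ 2 := Eventually.of_forall fun x => by positivity
    refine lt_of_le_of_ne (integral_nonneg_of_ae h0) fun h => ?_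
    rw [eq_comm, integral_eq_zero_iff_of_nonneg_ae h0 i5] at h
    have : ∫ x, x ^ 2 / (x - lam) ∂ν = 0 := by
      rw [← integral_zero ℝ ℝ (μ := ν)]
      refine integral_congr_ae ?_
      filter_upwards [h, hν] with x hx hxν
      have := hxl x hxν
      have h0 := hx0 x hxν
      simp [this, h0] at hx
    rw [hF] at this
    exact (div_pos hg hb).ne' this
  set C := (∫ x, p x / (x - lam) ∂ν) / ∫ x, x ^ 2 / (x - lam) ^ 2 ∂ν with hC
  set J : ℝ → ℝ → ℝ := fun t x => ∫ s in (0 : ℝ)..t, Real.exp (g * s * x) * φ s with hJ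
  have hJc : Continuous (fun q : ℝ × ℝ => J q.1 q.2) :=
    intervalIntegral.continuous_parametric_intervalIntegral_of_continuous
      (f := fun (q : ℝ × ℝ) s => Real.exp (g * s * q.2) * φ s)
      (by simp only [Function.uncurry_def]; fun_prop) continuous_fst
  -- Duhamel's formula for the mode at `x`. Since `φ` is the integral of `v`, the equation with
  -- memory becomes a linear flow.
  set v : ℝ → ℝ → ℝ := fun t x => Real.exp (-g * t * x) * (p x + b * x ^ 2 * J t x) with hv
  have hvd : ∀ t x, HasDerivAt (fun t => v t x) (-g * x * v t x + b * x ^ 2 * φ t) t := by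
    intro t x
    have h1 : HasDerivAt (fun t => Real.exp (-g * t * x)) (Real.exp (-g * t * x) * (-g * x)) t := by
      simpa using (((hasDerivAt_id t).const_mul (-g)).mul_const x).exp
    have h2 : HasDerivAt (fun t => J t x) (Real.exp (g * t * x) * φ t) t := by
      have hc : Continuous fun s => Real.exp (g * s * x) * φ s := by fun_prop
      exact intervalIntegral.integral_hasDerivAt_right (hc.intervalIntegrable _ _)
        (hc.stronglyMeasurableAtFilter _ _) hc.continuousAt
    refine (h1.mul ((h2.const_mul (b * x ^ 2)).const_add (p x))).congr_deriv ?_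
    have : Real.exp (-g * t * x) * Real.exp (g * t * x) = 1 := by
      rw [← Real.exp_add]; simp
    change _ = -g * x * (Real.exp (-g * t * x) * (p x + b * x ^ 2 * J t x)) + b * x ^ 2 * φ t
    linear_combination (b * x ^ 2 * φ t) * this
  have hvint : ∀ t, 0 ≤ t → φ t = ∫ x, v t x ∂ν := by
    intro t ht
    rw [heq t ht]
    have hsw : ∫ s in (0 : ℝ)..t, ∫ x, b * x ^ 2 * Real.exp (-g * (t - s) * x) * φ s ∂ν =
        ∫ x, (∫ s in (0 : ℝ)..t, b * x ^ 2 * Real.exp (-g * (t - s) * x) * φ s) ∂ν := by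
      refine intervalIntegral_integral_swap
        (f := fun s x => b * x ^ 2 * Real.exp (-g * (t - s) * x) * φ s) ?_
      rw [← Measure.restrict_eq_self_of_ae_mem hν, Measure.prod_restrict, ← IntegrableOn]
      refine IntegrableOn.mono_set (t := uIcc 0 t ×ˢ Icc e M) ?_
        (prod_mono uIoc_subset_uIcc le_rfl)
      refine ContinuousOn.integrableOn_compact (isCompact_uIcc.prod isCompact_Icc) ?_
      refine Continuous.continuousOn ?_
      simp only [Function.uncurry_def]
      fun_prop
    have h1 : ∫ s in (0 : ℝ)..t, b * (∫ x, x ^ 2 * Real.exp (-g * (t - s) * x) ∂ν) * φ s =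
        ∫ s in (0 : ℝ)..t, ∫ x, b * x ^ 2 * Real.exp (-g * (t - s) * x) * φ s ∂ν := by
      refine intervalIntegral.integral_congr fun s _ => ?_
      rw [integral_mul_const, ← integral_const_mul]
      simp only [mul_assoc]
    have h2 : ∀ x, ∫ s in (0 : ℝ)..t, b * x ^ 2 * Real.exp (-g * (t - s) * x) * φ s =
        b * x ^ 2 * Real.exp (-g * t * x) * J t x := by
      intro x
      rw [hJ, ← intervalIntegral.integral_const_mul]
      refine intervalIntegral.integral_congr fun s _ => ?_
      rw [show -g * (t - s) * x = -g * t * x + g * s * x by ring, Real.exp_add]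
      ring
    have hJs : Continuous (J t) := hJc.comp (by fun_prop : Continuous fun x : ℝ => (t, x))
    have i1 : Integrable (fun x => p x * Real.exp (-g * t * x)) ν := hi (by fun_prop)
    have i2 : Integrable (fun x => b * x ^ 2 * Real.exp (-g * t * x) * J t x) ν := hi (by fun_prop)
    rw [h1, hsw, integral_congr_ae (Eventually.of_forall h2)]
    refine (integral_add i1 i2).symm.trans
      (integral_congr_ae (Eventually.of_forall fun x => ?_))
    simp only [hv]
    ring
  -- The evolved ground state is removed; `C` is the projection coefficient that makes `u 0`
  -- orthogonal to it.
  set u : ℝ → ℝ → ℝ := fun t x => v t x - C * Real.exp (-g * lam * t) * (x ^ 2 / (x - lam)) with hu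
  set Φ : ℝ → ℝ := fun t => φ t - C * Real.exp (-g * lam * t) * (g / b) with hΦ
  have hvc : Continuous (fun q : ℝ × ℝ => v q.1 q.2) := by simp only [hv]; fun_prop
  have hvs : ∀ t, Continuous (v t) := fun t =>
    hvc.comp (by fun_prop : Continuous fun x : ℝ => (t, x))
  obtain ⟨D, hD⟩ := sq_le_of_orthogonal_flow hν he hg hb hlam hF (u := u) (Φ := Φ)
    (by simp only [hΦ]; fun_prop)
    (by
      simp only [Function.uncurry_def, hu]
      have := hvc.continuousOn (s := univ ×ˢ Icc e M)
      fun_prop (disch := assumption))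
    (fun t x hx => by
      have h1 : HasDerivAt (fun t => Real.exp (-g * lam * t))
          (Real.exp (-g * lam * t) * (-g * lam)) t := by
        simpa using ((hasDerivAt_id t).const_mul (-g * lam)).exp
      have h2 := (hvd t x).sub ((h1.const_mul C).mul_const (x ^ 2 / (x - lam)))
      refine HasDerivAt.congr_deriv h2 ?_
      simp only [hu, hΦ]
      have := hxl x hx
      field_simp
      ring)
    (fun t ht => by
      simp only [hu, hΦ]
      rw [integral_sub (hi (hvs t).continuousOn) (i4.const_mul _), integral_const_mul, hF,
        ← hvint t ht])
    (by
      have h1 : ∫ x, u 0 x / (x - lam) ∂ν =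
          ∫ x, (p x / (x - lam) - C * (x ^ 2 / (x - lam) ^ 2)) ∂ν := by
        refine integral_congr_ae ?_
        filter_upwards [hν] with x hx
        have := hxl x hx
        simp only [hu, hv, hJ, intervalIntegral.integral_same]
        simp
        field_simp
      rw [h1, integral_sub (hi (by fun_prop (disch := assumption))) (i5.const_mul _),
        integral_const_mul, hC]
      field_simp
      ring)
  have hlim : Tendsto (fun t => Real.exp (g * lam * t) * Φ t) atTop (𝓝 0) := by
    have hsq : Tendsto (fun t => (Real.exp (g * lam * t) * Φ t) ^ 2) atTop (𝓝 0) := by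
      have h1 : Tendsto (fun t => D * Real.exp (-(2 * g * (e - lam) * t))) atTop (𝓝 (D * 0)) := by
        refine Tendsto.const_mul _ (Real.tendsto_exp_neg_atTop_nhds_zero.comp ?_)
        exact tendsto_id.const_mul_atTop (by have := sub_pos.2 hlam; positivity)
      rw [mul_zero] at h1
      refine squeeze_zero' (Eventually.of_forall fun t => sq_nonneg _) ?_ h1
      filter_upwards [eventually_ge_atTop 0] with t ht
      rw [mul_pow]
      have h2 := mul_le_mul_of_nonneg_left (hD t ht) (sq_nonneg (Real.exp (g * lam * t)))
      refine h2.trans (le_of_eq ?_)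
      rw [← Real.exp_nat_mul, mul_left_comm, ← Real.exp_add]
      push_cast
      ring_nf
    have := (Real.continuous_sqrt.tendsto 0).comp hsq
    simp only [Real.sqrt_zero, Function.comp_def, Real.sqrt_sq_eq_abs] at this
    exact (tendsto_zero_iff_abs_tendsto_zero _).2 this
  have := hlim.add_const (g / b * C)
  rw [zero_add] at this
  refine this.congr fun t => ?_
  have h1 : Real.exp (g * lam * t) * Real.exp (-g * lam * t) = 1 := by
    rw [← Real.exp_add]; simp
  simp only [hΦ]
  linear_combination (-C * (g / b)) * h1

end Energy

/-! ### The left edge of the support and the atom at zero -/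

section LeftEdge

variable {μ : Measure ℝ} {M : ℝ}

lemma bddBelow_support_restrict_Ioi : BddBelow (μ.restrict (Ioi 0)).support := by
  refine ⟨0, fun x hx => ?_⟩
  have := Measure.support_restrict_subset hx
  rw [closure_Ioi] at this
  exact this.1

/-- A positive edge excludes the empty support, for which `sInf ∅ = 0`; the infimum of a nonempty
closed set bounded below belongs to it. -/
lemma leftEdge_mem_support (hedge : 0 < leftEdge μ) :
    leftEdge μ ∈ (μ.restrict (Ioi 0)).support := by
  refine Measure.isClosed_support.csInf_mem ?_ bddBelow_support_restrict_Ioi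
  by_contra h
  rw [not_nonempty_iff_eq_empty] at h
  rw [leftEdge, h, Real.sInf_empty] at hedge
  exact hedge.false

lemma ae_restrict_mem_Icc (hμ : μ (Icc 0 M)ᶜ = 0) :
    ∀ᵐ x ∂(μ.restrict (Ioi 0)), x ∈ Icc (leftEdge μ) M := by
  have h1 : ∀ᵐ x ∂(μ.restrict (Ioi 0)), x ∈ (μ.restrict (Ioi 0)).support :=
    Measure.support_mem_ae
  have h2 : ∀ᵐ x ∂(μ.restrict (Ioi 0)), x ∈ Icc 0 M :=
    ae_restrict_of_ae (mem_ae_iff.2 hμ)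
  filter_upwards [h1, h2] with x hx hx'
  exact ⟨csInf_le bddBelow_support_restrict_Ioi hx, hx'.2⟩

lemma measure_Ioo_leftEdge_pos (hedge : 0 < leftEdge μ) {ε : ℝ} (hε : 0 < ε) :
    0 < (μ.restrict (Ioi 0)) (Ioo (leftEdge μ - ε) (leftEdge μ + ε)) :=
  (Measure.mem_support_iff_forall _).1 (leftEdge_mem_support hedge) _
    (Ioo_mem_nhds (by linarith) (by linarith))

lemma integral_eq_atom_add [IsFiniteMeasure μ] (hμ : μ (Icc 0 M)ᶜ = 0) {f : ℝ → ℝ}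
    (hf : Integrable f (μ.restrict (Ioi 0))) :
    ∫ x, f x ∂μ = f 0 * μ.real {0} + ∫ x in Ioi 0, f x ∂μ := by
  have hset : ((Ioi (0 : ℝ))ᶜ : Set ℝ) =ᵐ[μ] ({0} : Set ℝ) := by
    have h : ∀ᵐ x ∂μ, x ∈ Icc 0 M := mem_ae_iff.2 hμ
    filter_upwards [h] with x hx
    refine propext ?_
    change ¬ (0 < x) ↔ x = 0
    constructor
    · exact fun h => le_antisymm (not_lt.1 h) hx.1
    · rintro rfl; exact lt_irrefl _
  have hc : IntegrableOn f (Ioi 0)ᶜ μ :=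
    (integrableOn_singleton (by simp)).congr_set_ae hset
  rw [← integral_add_compl measurableSet_Ioi
      (integrableOn_univ.1 (by rw [← union_compl_self (Ioi (0 : ℝ))]; exact IntegrableOn.union hf hc)),
    add_comm]
  congr 1
  rw [setIntegral_congr_set hset, integral_singleton, smul_eq_mul, mul_comm]

lemma integral_eq_restrict (hμ : μ (Icc 0 M)ᶜ = 0) {f : ℝ → ℝ} (hf : f 0 = 0) :
    ∫ x, f x ∂μ = ∫ x, f x ∂(μ.restrict (Ioi 0)) := by
  refine (setIntegral_eq_integral_of_ae_compl_eq_zero ?_).symm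
  have h : ∀ᵐ x ∂μ, x ∈ Icc 0 M := mem_ae_iff.2 hμ
  filter_upwards [h] with x hx hx'
  rw [le_antisymm (not_lt.1 hx') hx.1, hf]

end LeftEdge

/-! ### The resolvent integral and the Malthusian exponent -/

section Malthus

/-- For `b ≤ 0` both sides are infinite. Allowing this case lets the Malthusian criterion cover
every real exponent, including those beyond the edge. -/
lemma lintegral_exp_neg_mul_Ioi (b : ℝ) :
    ∫⁻ t in Ioi (0 : ℝ), ENNReal.ofReal (Real.exp (-b * t)) = (ENNReal.ofReal b)⁻¹ := by
  rcases lt_or_ge 0 b with hb | hb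
  · rw [← ofReal_integral_eq_lintegral_ofReal]
    · rw [integral_exp_mul_Ioi (by linarith : -b < 0)]
      rw [← ENNReal.ofReal_inv_of_pos hb]
      congr 1
      simp
    · exact integrableOn_exp_mul_Ioi (by linarith) 0
    · exact Eventually.of_forall fun t => (Real.exp_pos _).le
  · rw [ENNReal.ofReal_of_nonpos hb, ENNReal.inv_zero, eq_top_iff]
    calc (⊤ : ℝ≥0∞) = ∫⁻ t in Ioi (0 : ℝ), 1 := by simp
      _ ≤ _ := by
        refine setLIntegral_mono (by fun_prop) fun t ht => ?_
        rw [ENNReal.one_le_ofReal, Real.one_le_exp_iff]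
        exact mul_nonneg (by linarith) (le_of_lt ht)

lemma lintegral_exp_mixture {ν : Measure ℝ} [SFinite ν] {g : ℝ → ℝ} {c lam : ℝ}
    (hg : Measurable g) (hg0 : ∀ᵐ x ∂ν, 0 ≤ g x)
    (hint : ∀ t, 0 ≤ t → Integrable (fun x => g x * Real.exp (-c * t * (x - lam))) ν) :
    ∫⁻ t in Ioi (0 : ℝ), ENNReal.ofReal (∫ x, g x * Real.exp (-c * t * (x - lam)) ∂ν) =
      ∫⁻ x, ENNReal.ofReal (g x) * (ENNReal.ofReal (c * (x - lam)))⁻¹ ∂ν := by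
  have h1 : ∫⁻ t in Ioi (0 : ℝ), ENNReal.ofReal (∫ x, g x * Real.exp (-c * t * (x - lam)) ∂ν) =
      ∫⁻ t in Ioi (0 : ℝ), ∫⁻ x, ENNReal.ofReal (g x) *
        ENNReal.ofReal (Real.exp (-(c * (x - lam)) * t)) ∂ν := by
    refine setLIntegral_congr_fun measurableSet_Ioi fun t ht => ?_
    rw [ofReal_integral_eq_lintegral_ofReal (hint t (le_of_lt ht))]
    · refine lintegral_congr_ae ?_
      filter_upwards [hg0] with x hx
      rw [ENNReal.ofReal_mul hx]
      ring_nf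
    · filter_upwards [hg0] with x hx
      exact mul_nonneg hx (Real.exp_pos _).le
  rw [h1, lintegral_lintegral_swap]
  · refine lintegral_congr fun x => ?_
    rw [lintegral_const_mul _ (by fun_prop), lintegral_exp_neg_mul_Ioi]
  · refine Measurable.aemeasurable ?_
    simp only [Function.uncurry_def]
    fun_prop

variable {μ : Measure ℝ} {M : ℝ}

/-- Monotone on all of `ℝ`, because `ENNReal.ofReal` truncates a negative denominator to `0`. -/
lemma resolventIntegral_mono : Monotone (resolventIntegral μ) := fun a b hab =>
  lintegral_mono fun x => ENNReal.div_le_div_left (ENNReal.ofReal_le_ofReal (by linarith)) _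

lemma lintegral_malthus [IsFiniteMeasure μ] {r γ lam : ℝ} (hμ : μ (Icc 0 M)ᶜ = 0) (hr : 0 < r) (hγ : 0 < γ) :
    ∫⁻ t in Ioi (0 : ℝ),
      ENNReal.ofReal (Real.exp (2 * γ * lam * t) * (γ ^ 2 * r * h μ γ 2 t)) =
    ENNReal.ofReal (γ * r / 2) * resolventIntegral μ lam := by
  have hM : ∀ᵐ x ∂μ, x ∈ Icc 0 M := mem_ae_iff.2 hμ
  have h1 : ∀ t, Real.exp (2 * γ * lam * t) * (γ ^ 2 * r * h μ γ 2 t) =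
      ∫ x, γ ^ 2 * r * x ^ 2 * Real.exp (-(2 * γ) * t * (x - lam)) ∂μ := by
    intro t
    rw [h, ← mul_assoc, ← integral_const_mul]
    congr 1
    ext x
    rw [show -(2 * γ) * t * (x - lam) = 2 * γ * lam * t + -2 * γ * t * x by ring, Real.exp_add]
    ring
  simp only [h1]
  rw [lintegral_exp_mixture (by fun_prop) (Eventually.of_forall fun x => by positivity)
    (fun t _ => integrable_of_continuousOn hM (by fun_prop)), resolventIntegral,
    ← lintegral_const_mul' _ _ ENNReal.ofReal_ne_top]
  refine lintegral_congr fun x => ?_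
  rw [ENNReal.ofReal_mul (p := 2 * γ) (by positivity),
    ENNReal.mul_inv (Or.inl (by positivity)) (Or.inl ENNReal.ofReal_ne_top),
    show γ ^ 2 * r * x ^ 2 = (γ * r / 2) * (2 * γ) * x ^ 2 by ring,
    ENNReal.ofReal_mul (by positivity), ENNReal.ofReal_mul (by positivity),
    div_eq_mul_inv (ENNReal.ofReal (x ^ 2))]
  have h2 : ENNReal.ofReal (2 * γ) * (ENNReal.ofReal (2 * γ))⁻¹ = 1 :=
    ENNReal.mul_inv_cancel (by positivity) ENNReal.ofReal_ne_top
  calc _ = ENNReal.ofReal (γ * r / 2) * (ENNReal.ofReal (x ^ 2) * (ENNReal.ofReal (x - lam))⁻¹) *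
        (ENNReal.ofReal (2 * γ) * (ENNReal.ofReal (2 * γ))⁻¹) := by ring
    _ = _ := by rw [h2, mul_one]

lemma isMalthusianExponent_iff [IsFiniteMeasure μ] {r γ lam : ℝ} (hμ : μ (Icc 0 M)ᶜ = 0) (hr : 0 < r) (hγ : 0 < γ) :
    IsMalthusianExponent μ r γ lam ↔
      resolventIntegral μ lam = ENNReal.ofReal (2 / (γ * r)) := by
  rw [IsMalthusianExponent, lintegral_malthus hμ hr hγ]
  have hpos : ENNReal.ofReal (γ * r / 2) ≠ 0 := by positivity
  rw [show 2 / (γ * r) = (γ * r / 2)⁻¹ by rw [inv_div],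
    ENNReal.ofReal_inv_of_pos (by positivity)]
  constructor
  · intro h
    exact ENNReal.eq_inv_of_mul_eq_one_left (by rwa [mul_comm])
  · intro h
    rw [h, ENNReal.mul_inv_cancel hpos ENNReal.ofReal_ne_top]

lemma resolvent_eq_iff {r γ lam : ℝ} (hr : 0 < r) (hγ : 0 < γ) :
    ENNReal.ofReal (r / 2) * resolventIntegral μ lam = ENNReal.ofReal (1 / γ) ↔
      resolventIntegral μ lam = ENNReal.ofReal (2 / (γ * r)) := by
  have hpos : ENNReal.ofReal (r / 2) ≠ 0 := by positivity
  rw [show 1 / γ = r / 2 * (2 / (γ * r)) by field_simp, ENNReal.ofReal_mul (by positivity)]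
  exact ENNReal.mul_right_inj hpos ENNReal.ofReal_ne_top

lemma resolventIntegral_eq_restrict (hμ : μ (Icc 0 M)ᶜ = 0) (lam : ℝ) :
    resolventIntegral μ lam =
      ∫⁻ x in Ioi 0, ENNReal.ofReal (x ^ 2) / ENNReal.ofReal (x - lam) ∂μ := by
  rw [resolventIntegral, ← lintegral_add_compl _ measurableSet_Ioi]
  convert add_zero _
  rw [lintegral_eq_zero_iff' (by fun_prop)]
  have h : ∀ᵐ x ∂μ, x ∈ Icc 0 M := mem_ae_iff.2 hμ
  rw [EventuallyEq, ae_restrict_iff' measurableSet_Ioi.compl]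
  filter_upwards [h] with x hx hx'
  have : x = 0 := le_antisymm (not_lt.1 hx') hx.1
  simp [this]

/-- The measure restricted to `(0, ∞)` gives `resolventIntegral` as a Bochner integral, below any
point where the latter is finite. -/
lemma resolventIntegral_eq_ofReal (hμ : μ (Icc 0 M)ᶜ = 0) {lam : ℝ}
    (hpos : ∀ᵐ x ∂(μ.restrict (Ioi 0)), lam < x)
    (hint : Integrable (fun x => x ^ 2 / (x - lam)) (μ.restrict (Ioi 0))) :
    resolventIntegral μ lam = ENNReal.ofReal (∫ x in Ioi 0, x ^ 2 / (x - lam) ∂μ) := by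
  rw [resolventIntegral_eq_restrict hμ, ofReal_integral_eq_lintegral_ofReal hint]
  · refine lintegral_congr_ae ?_
    filter_upwards [hpos] with x hx
    rw [ENNReal.ofReal_div_of_pos (sub_pos.2 hx)]
  · filter_upwards [hpos] with x hx
    exact div_nonneg (sq_nonneg _) (sub_pos.2 hx).le

lemma integrable_resolvent_of_lt [IsFiniteMeasure μ] (hμ : μ (Icc 0 M)ᶜ = 0) {lam : ℝ}
    (hlam : lam < leftEdge μ) {f : ℝ → ℝ} (hf : Continuous f) :
    Integrable (fun x => f x / (x - lam)) (μ.restrict (Ioi 0)) := by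
  refine integrable_of_continuousOn (ae_restrict_mem_Icc hμ) ?_
  have : ∀ x ∈ Icc (leftEdge μ) M, x - lam ≠ 0 := fun x hx =>
    (sub_pos.2 (hlam.trans_le hx.1)).ne'
  fun_prop (disch := assumption)

lemma resolventIntegral_of_lt [IsFiniteMeasure μ] (hμ : μ (Icc 0 M)ᶜ = 0) {lam : ℝ} (hlam : lam < leftEdge μ) :
    resolventIntegral μ lam = ENNReal.ofReal (∫ x in Ioi 0, x ^ 2 / (x - lam) ∂μ) := by
  refine resolventIntegral_eq_ofReal hμ ?_ (integrable_resolvent_of_lt hμ hlam (by fun_prop))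
  filter_upwards [ae_restrict_mem_Icc hμ] with x hx using hlam.trans_le hx.1

lemma restrict_Ioi_ne_zero (hedge : 0 < leftEdge μ) : μ.restrict (Ioi 0) ≠ 0 := by
  intro h
  have := measure_Ioo_leftEdge_pos hedge one_pos
  simp [h] at this

lemma integral_restrict_pos (hedge : 0 < leftEdge μ) {f : ℝ → ℝ}
    (hf : ∀ᵐ x ∂(μ.restrict (Ioi 0)), 0 < f x) (hint : Integrable f (μ.restrict (Ioi 0))) :
    0 < ∫ x in Ioi 0, f x ∂μ := by
  have h0 : 0 ≤ᵐ[μ.restrict (Ioi 0)] f := hf.mono fun x hx => hx.le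
  refine lt_of_le_of_ne (integral_nonneg_of_ae h0) fun h => restrict_Ioi_ne_zero hedge ?_
  rw [eq_comm, integral_eq_zero_iff_of_nonneg_ae h0 hint] at h
  rw [← ae_eq_bot]
  refine empty_mem_iff_bot.1 ?_
  filter_upwards [h, hf] with x h1 h2
  exact h2.ne' h1

lemma strictMonoOn_resolvent [IsFiniteMeasure μ] (hμ : μ (Icc 0 M)ᶜ = 0) (hedge : 0 < leftEdge μ) :
    StrictMonoOn (fun lam => ∫ x in Ioi 0, x ^ 2 / (x - lam) ∂μ) (Iio (leftEdge μ)) := by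
  intro a ha b hb hab
  have ha' := integrable_resolvent_of_lt hμ ha (f := fun x => x ^ 2) (by fun_prop)
  have hb' := integrable_resolvent_of_lt hμ hb (f := fun x => x ^ 2) (by fun_prop)
  simp only
  rw [← sub_pos, ← integral_sub hb' ha']
  refine integral_restrict_pos hedge ?_ (hb'.sub ha')
  filter_upwards [ae_restrict_mem_Icc hμ] with x hx
  have h1 : 0 < x - b := sub_pos.2 (lt_of_lt_of_le hb hx.1)
  have h2 : 0 < x := hedge.trans_le hx.1
  rw [sub_pos]
  gcongr

lemma continuousOn_resolvent [IsFiniteMeasure μ] (hμ : μ (Icc 0 M)ᶜ = 0) :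
    ContinuousOn (fun lam => ∫ x in Ioi 0, x ^ 2 / (x - lam) ∂μ) (Iio (leftEdge μ)) := by
  intro a ha
  obtain ⟨b, hab, hb⟩ := exists_between (show a < leftEdge μ from ha)
  refine ContinuousAt.continuousWithinAt ?_
  refine continuousAt_of_dominated (bound := fun x => x ^ 2 / (x - b)) ?_ ?_
    (integrable_resolvent_of_lt hμ hb (by fun_prop)) ?_
  · exact Eventually.of_forall fun lam => Measurable.aestronglyMeasurable (by fun_prop)
  · filter_upwards [Iio_mem_nhds hab] with lam hlam
    filter_upwards [ae_restrict_mem_Icc hμ] with x hx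
    have h1 : 0 < x - b := sub_pos.2 (lt_of_lt_of_le hb hx.1)
    have h2 : lam < b := hlam
    have h3 : 0 < x - lam := by linarith
    rw [Real.norm_of_nonneg (by positivity)]
    gcongr
  · filter_upwards [ae_restrict_mem_Icc hμ] with x hx
    have h1 : x - a ≠ 0 := (sub_pos.2 (lt_of_lt_of_le ha hx.1)).ne'
    exact continuousAt_const.div (continuousAt_const.sub continuousAt_id) h1

/-- Fatou along a sequence increasing to the edge. It yields a point strictly below the edge where
the integral already exceeds the level to be attained. -/
lemma resolventIntegral_leftEdge_le {c : ℝ≥0∞}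
    (hc : ∀ lam < leftEdge μ, resolventIntegral μ lam ≤ c) :
    resolventIntegral μ (leftEdge μ) ≤ c := by
  set e := leftEdge μ
  obtain ⟨u, -, hu, hlim⟩ := exists_seq_strictMono_tendsto e
  calc resolventIntegral μ e
      = ∫⁻ x, liminf (fun n => ENNReal.ofReal (x ^ 2) / ENNReal.ofReal (x - u n)) atTop ∂μ := by
        refine lintegral_congr fun x => (Tendsto.liminf_eq ?_).symm
        exact ENNReal.Tendsto.const_div (ENNReal.tendsto_ofReal (hlim.const_sub x))
          (Or.inr ENNReal.ofReal_ne_top)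
    _ ≤ liminf (fun n => resolventIntegral μ (u n)) atTop :=
        lintegral_liminf_le fun n => by fun_prop
    _ ≤ liminf (fun _ : ℕ => c) atTop := liminf_le_liminf (Eventually.of_forall fun n => hc _ (hu n))
    _ = c := liminf_const c

lemma firstMoment_eq (hμ : μ (Icc 0 M)ᶜ = 0) : firstMoment μ = ∫ x in Ioi 0, x ∂μ :=
  integral_eq_restrict hμ rfl

lemma firstMoment_eq_resolvent (hμ : μ (Icc 0 M)ᶜ = 0) :
    firstMoment μ = ∫ x in Ioi 0, x ^ 2 / (x - 0) ∂μ := by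
  rw [firstMoment_eq hμ]
  refine setIntegral_congr_fun measurableSet_Ioi fun x hx => ?_
  have : x ≠ 0 := ne_of_gt hx
  field_simp
  ring

lemma firstMoment_pos [IsFiniteMeasure μ] (hμ : μ (Icc 0 M)ᶜ = 0) (hedge : 0 < leftEdge μ) : 0 < firstMoment μ := by
  rw [firstMoment_eq hμ]
  refine integral_restrict_pos hedge ?_ (integrable_of_continuousOn (ae_restrict_mem_Icc hμ)
    (by fun_prop))
  filter_upwards [ae_restrict_mem_Icc hμ] with x hx using hedge.trans_le hx.1

lemma ofReal_firstMoment_le_resolventIntegral [IsFiniteMeasure μ] (hμ : μ (Icc 0 M)ᶜ = 0) (hedge : 0 < leftEdge μ) :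
    ENNReal.ofReal (firstMoment μ) ≤ resolventIntegral μ (leftEdge μ) := by
  rw [firstMoment_eq_resolvent hμ, ← resolventIntegral_of_lt hμ hedge]
  exact resolventIntegral_mono hedge.le

/-- Rules out the inverse `0⁻¹ = ⊤` in the critical stepsize, whose `toReal` would be `0`. -/
lemma ofReal_mul_resolventIntegral_ne_zero [IsFiniteMeasure μ] (hμ : μ (Icc 0 M)ᶜ = 0) (hedge : 0 < leftEdge μ)
    {r : ℝ} (hr : 0 < r) : ENNReal.ofReal (r / 2) * resolventIntegral μ (leftEdge μ) ≠ 0 := by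
  have h2 : 0 < ENNReal.ofReal (firstMoment μ) := ENNReal.ofReal_pos.2 (firstMoment_pos hμ hedge)
  have h3 := h2.trans_le (ofReal_firstMoment_le_resolventIntegral hμ hedge)
  have h4 : 0 < ENNReal.ofReal (r / 2) := by positivity
  exact (ENNReal.mul_pos h4.ne' h3.ne').ne'

lemma criticalStepsize_lt_iff [IsFiniteMeasure μ] (hμ : μ (Icc 0 M)ᶜ = 0) (hedge : 0 < leftEdge μ) {r γ : ℝ}
    (hr : 0 < r) (hγ : 0 < γ) : criticalStepsize μ r < γ ↔
      ENNReal.ofReal (1 / γ) < ENNReal.ofReal (r / 2) * resolventIntegral μ (leftEdge μ) := by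
  have h0 := ofReal_mul_resolventIntegral_ne_zero hμ hedge hr
  rw [criticalStepsize, ← ENNReal.lt_ofReal_iff_toReal_lt (ENNReal.inv_ne_top.2 h0), one_div,
    ENNReal.ofReal_inv_of_pos hγ]
  exact ENNReal.inv_lt_iff_inv_lt

lemma lt_criticalStepsize_iff [IsFiniteMeasure μ] (hμ : μ (Icc 0 M)ᶜ = 0) (hedge : 0 < leftEdge μ) {r γ : ℝ}
    (hr : 0 < r) (hγ : 0 < γ) : γ < criticalStepsize μ r ↔
      ENNReal.ofReal (r / 2) * resolventIntegral μ (leftEdge μ) < ENNReal.ofReal (1 / γ) := by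
  have h0 := ofReal_mul_resolventIntegral_ne_zero hμ hedge hr
  rw [criticalStepsize, ← ENNReal.ofReal_lt_iff_lt_toReal hγ.le (ENNReal.inv_ne_top.2 h0), one_div,
    ENNReal.ofReal_inv_of_pos hγ]
  exact ENNReal.lt_inv_iff_lt_inv

/-- Existence, uniqueness and location of the Malthusian exponent. -/
theorem existsUnique_resolvent_eq [IsFiniteMeasure μ] (hμ : μ (Icc 0 M)ᶜ = 0) (hedge : 0 < leftEdge μ) {r γ : ℝ}
    (hr : 0 < r) (hγ : 0 < γ) (h1 : criticalStepsize μ r < γ) (h2 : γ < maxStepsize μ r) :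
    ∃ lam, 0 < lam ∧ lam < leftEdge μ ∧ ∀ lam',
      resolventIntegral μ lam' = ENNReal.ofReal (2 / (γ * r)) ↔ lam' = lam := by
  have hm := firstMoment_pos hμ hedge
  have hc : 0 < 2 / (γ * r) := by positivity
  -- This is `γ < γ_0`, because the resolvent integral at `0` is the first moment.
  have hlow : ∫ x in Ioi 0, x ^ 2 / (x - 0) ∂μ < 2 / (γ * r) := by
    rw [← firstMoment_eq_resolvent hμ, lt_div_iff₀ (by positivity)]
    rw [maxStepsize, lt_inv_comm₀ hγ (by positivity), lt_inv_comm₀ (by positivity) hγ,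
      ← one_div, lt_div_iff₀ (by positivity)] at h2
    linarith
  have hhigh : ENNReal.ofReal (2 / (γ * r)) < resolventIntegral μ (leftEdge μ) := by
    rw [criticalStepsize_lt_iff hμ hedge hr hγ,
      show 1 / γ = r / 2 * (2 / (γ * r)) by field_simp, ENNReal.ofReal_mul (by positivity)] at h1
    by_contra! h
    exact absurd h1 (not_lt.2 (mul_le_mul_right h _))
  obtain ⟨b, hb, hbc⟩ : ∃ b < leftEdge μ, ENNReal.ofReal (2 / (γ * r)) < resolventIntegral μ b := by
    by_contra! h
    exact absurd (resolventIntegral_leftEdge_le h) (not_le.2 hhigh)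
  rw [resolventIntegral_of_lt hμ hb, ENNReal.ofReal_lt_ofReal_iff_of_nonneg hc.le] at hbc
  have hsm := strictMonoOn_resolvent hμ hedge
  have hb0 : 0 < b := (hsm.lt_iff_lt hedge hb).1 (hlow.trans hbc)
  obtain ⟨lam, hlam, hval⟩ := intermediate_value_Ioo hb0.le
    ((continuousOn_resolvent hμ).mono fun x hx => lt_of_le_of_lt hx.2 hb) ⟨hlow, hbc⟩
  have hle : lam < leftEdge μ := hlam.2.trans hb
  refine ⟨lam, hlam.1, hle, fun lam' => ⟨fun h => ?_, fun h => ?_⟩⟩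
  · rcases lt_or_ge lam' (leftEdge μ) with hl | hl
    · rw [resolventIntegral_of_lt hμ hl, ENNReal.ofReal_eq_ofReal_iff ?_ hc.le] at h
      · exact hsm.injOn hl hle (h.trans hval.symm)
      · refine integral_nonneg_of_ae ?_
        filter_upwards [ae_restrict_mem_Icc hμ] with x hx
        exact div_nonneg (sq_nonneg _) (by linarith [hx.1])
    -- From the edge on, the integral stays strictly above the level, so no root lies there.
    · have := hhigh.trans_le (resolventIntegral_mono hl)
      exact absurd h this.ne'
  · rw [h, resolventIntegral_of_lt hμ hle]
    exact congrArg _ hval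

end Malthus

/-! ### Continuity of solutions and the deviation equation -/

section Volterra

variable {μ : Measure ℝ} {M : ℝ}

lemma hasDerivAt_h [IsFiniteMeasure μ] (hμ : μ (Icc 0 M)ᶜ = 0) (γ : ℝ) (k : ℕ) (t : ℝ) :
    HasDerivAt (h μ γ k) (-(2 * γ) * h μ γ (k + 1) t) t := by
  have hM : ∀ᵐ x ∂μ, x ∈ Icc 0 M := mem_ae_iff.2 hμ
  refine (hasDerivAt_integral_of_continuousOn hM
    (u := fun t x => x ^ k * Real.exp (-2 * γ * t * x))
    (u' := fun t x => -(2 * γ) * (x ^ (k + 1) * Real.exp (-2 * γ * t * x)))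
    (by simp only [Function.uncurry_def]; fun_prop)
    (by simp only [Function.uncurry_def]; fun_prop) (fun t x _ => ?_) t).congr_deriv
    (integral_const_mul _ _)
  have h1 : HasDerivAt (fun t => Real.exp (-2 * γ * t * x))
      (Real.exp (-2 * γ * t * x) * (-2 * γ * x)) t := by
    simpa using (((hasDerivAt_id t).const_mul (-2 * γ)).mul_const x).exp
  refine (h1.const_mul (x ^ k)).congr_deriv ?_
  ring

lemma continuous_h [IsFiniteMeasure μ] (hμ : μ (Icc 0 M)ᶜ = 0) (γ : ℝ) (k : ℕ) :
    Continuous (h μ γ k) :=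
  continuous_iff_continuousAt.2 fun t => (hasDerivAt_h hμ γ k t).continuousAt

/-- The Volterra integral of a locally integrable function against a continuous kernel is
continuous. -/
lemma continuousOn_volterra_integral {K ψ : ℝ → ℝ} (hK : Continuous K)
    (hψ : ∀ t, 0 ≤ t → IntervalIntegrable ψ volume 0 t) :
    ContinuousOn (fun t => ∫ s in (0 : ℝ)..t, K (t - s) * ψ s) (Ici 0) := by
  -- Extending by zero to the left makes `t = 0` interior to the interval `(-1, t₀ + 1)` on which
  -- domination is needed.
  set χ : ℝ → ℝ := indicator (Ioi 0) ψ with hχ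
  have hχint : ∀ T, 0 ≤ T → IntervalIntegrable χ volume (-1) T := by
    intro T hT
    rw [intervalIntegrable_iff_integrableOn_Ioc_of_le (by linarith), hχ,
      integrableOn_indicator_iff measurableSet_Ioi]
    exact ((intervalIntegrable_iff_integrableOn_Ioc_of_le hT).1 (hψ T hT)).mono_set
      fun x hx => ⟨hx.1, hx.2.2⟩
  have hcont : ∀ t₀, 0 ≤ t₀ →
      ContinuousAt (fun t => ∫ s in (0 : ℝ)..t, K (t - s) * χ s) t₀ := by
    intro t₀ ht₀
    obtain ⟨C, hC⟩ := (isCompact_Icc (a := -(t₀ + 2)) (b := t₀ + 2)).exists_bound_of_continuousOn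
      hK.continuousOn
    have := intervalIntegral.continuousAt_parametric_primitive_of_dominated (μ := volume)
      (F := fun t s => K (t - s) * χ s) (fun s => C * |χ s|) (-1) (t₀ + 1) (a₀ := 0) (b₀ := t₀)
      (x₀ := t₀) ?_ ?_ ?_ ?_ ⟨by norm_num, by linarith⟩ ⟨by linarith, by linarith⟩ (by simp)
    · exact ContinuousAt.comp (g := fun p : ℝ × ℝ => ∫ s in (0 : ℝ)..p.2, K (p.1 - s) * χ s)
        (f := fun t => (t, t)) this (by fun_prop)
    · intro t
      refine AEStronglyMeasurable.mul (Continuous.aestronglyMeasurable (by fun_prop)) ?_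
      exact ((intervalIntegrable_iff.1 (hχint (t₀ + 1) (by linarith)))).aestronglyMeasurable
    · filter_upwards [Icc_mem_nhds (by linarith : t₀ - 1 < t₀) (by linarith : t₀ < t₀ + 1)]
        with t ht
      rw [ae_restrict_iff' measurableSet_uIoc]
      refine Eventually.of_forall fun s hs => ?_
      rw [uIoc_of_le (by linarith)] at hs
      rw [norm_mul]
      exact mul_le_mul_of_nonneg_right
        (hC _ ⟨by linarith [ht.1, hs.2], by linarith [ht.2, hs.1]⟩) (norm_nonneg _)
    · exact ((hχint (t₀ + 1) (by linarith)).abs).const_mul C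
    · exact Eventually.of_forall fun s => by fun_prop
  refine ContinuousOn.congr (fun t ht => (hcont t ht).continuousWithinAt) fun t ht => ?_
  rw [intervalIntegral.integral_of_le ht, intervalIntegral.integral_of_le ht]
  refine setIntegral_congr_fun measurableSet_Ioc fun s hs => ?_
  simp only [hχ, indicator_of_mem (show s ∈ Ioi 0 from hs.1)]

lemma IsVolterraSolution.continuousOn [IsFiniteMeasure μ] (hμ : μ (Icc 0 M)ᶜ = 0)
    {r R Rt γ : ℝ} {ψ : ℝ → ℝ} (hψ : IsVolterraSolution μ r R Rt γ ψ) :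
    ContinuousOn ψ (Ici 0) := by
  have h1 : ContinuousOn (forcing μ r R Rt γ) (Ici 0) := by
    unfold forcing
    have := continuous_h hμ γ 0
    have := continuous_h hμ γ 1
    fun_prop
  have h2 := continuousOn_volterra_integral
    (K := fun t => γ ^ 2 * r * h μ γ 2 t) (by have := continuous_h hμ γ 2; fun_prop)
    hψ.intervalIntegrable
  exact (h1.add h2).congr fun t ht => hψ.equation t ht

/-- `h_2` is, up to the factor `-2γ`, the derivative of `h_1`. The `h_1` term produced here is what
changes `R` into `R - γ r ψ_0(∞)` in the deviation equation. -/
lemma integral_kernel [IsFiniteMeasure μ] (hμ : μ (Icc 0 M)ᶜ = 0) (γ r t : ℝ) :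
    ∫ s in (0 : ℝ)..t, γ ^ 2 * r * h μ γ 2 (t - s) =
      γ * r / 2 * (firstMoment μ - h μ γ 1 t) := by
  rw [intervalIntegral.integral_const_mul,
    intervalIntegral.integral_comp_sub_left (fun s => h μ γ 2 s) t, sub_self, sub_zero]
  have h1 := intervalIntegral.integral_eq_sub_of_hasDerivAt (a := 0) (b := t)
    (fun s _ => hasDerivAt_h hμ γ 1 s)
    (((continuous_h hμ γ 2).const_mul _).intervalIntegrable _ _)
  rw [intervalIntegral.integral_const_mul] at h1
  have h2 : h μ γ 1 0 = firstMoment μ := by simp [h, firstMoment]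
  rw [h2] at h1
  linear_combination (-(γ * r / 2)) * h1

lemma h_eq_restrict (hμ : μ (Icc 0 M)ᶜ = 0) (γ t : ℝ) {k : ℕ} (hk : k ≠ 0) :
    h μ γ k t = ∫ x in Ioi 0, x ^ k * Real.exp (-(2 * γ) * t * x) ∂μ := by
  rw [h, integral_eq_restrict hμ (by simp [hk])]
  simp only [neg_mul]

lemma h_zero_eq [IsFiniteMeasure μ] (hμ : μ (Icc 0 M)ᶜ = 0) (γ t : ℝ) :
    h μ γ 0 t = μ.real {0} + ∫ x in Ioi 0, Real.exp (-(2 * γ) * t * x) ∂μ := by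
  rw [h, integral_eq_atom_add hμ]
  · simp
  · exact integrable_of_continuousOn (ae_restrict_mem_Icc hμ) (by fun_prop)

/-- The equation for the deviation of a solution from its limiting value. -/
theorem IsVolterraSolution.exists_deviation [IsFiniteMeasure μ] (hμ : μ (Icc 0 M)ᶜ = 0)
    {r R Rt γ : ℝ} {ψ : ℝ → ℝ} (hψ : IsVolterraSolution μ r R Rt γ ψ)
    (hden : 1 - γ * r / 2 * firstMoment μ ≠ 0) :
    ∃ φ : ℝ → ℝ, Continuous φ ∧ (∀ t, 0 ≤ t → φ t = ψ t - psiInfty μ r Rt γ) ∧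
      ∀ t, 0 ≤ t → φ t = ∫ x in Ioi 0, ((R - γ * r * psiInfty μ r Rt γ) / 2 * x + Rt * r / 2) *
          Real.exp (-(2 * γ) * t * x) ∂μ +
        ∫ s in (0 : ℝ)..t, γ ^ 2 * r *
          (∫ x in Ioi 0, x ^ 2 * Real.exp (-(2 * γ) * (t - s) * x) ∂μ) * φ s := by
  set P := psiInfty μ r Rt γ with hP
  have hψc := hψ.continuousOn hμ
  -- Freezing `ψ` at `ψ 0` on the negative axis makes the deviation continuous on `ℝ`.
  refine ⟨fun t => ψ (max t 0) - P, ?_, fun t ht => by simp only [max_eq_left ht], fun t ht => ?_⟩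
  · exact (hψc.comp_continuous (by fun_prop) fun t => mem_Ici.2 (le_max_right _ _)).sub continuous_const
  · have hi := fun {f : ℝ → ℝ} (hf : Continuous f) =>
      integrable_of_continuousOn (ae_restrict_mem_Icc hμ) hf.continuousOn
    have h1 : ∫ x in Ioi 0, ((R - γ * r * P) / 2 * x + Rt * r / 2) *
        Real.exp (-(2 * γ) * t * x) ∂μ = (R - γ * r * P) / 2 * h μ γ 1 t +
          Rt * r / 2 * (h μ γ 0 t - μ.real {0}) := by
      rw [h_zero_eq hμ, h_eq_restrict hμ γ t one_ne_zero, add_sub_cancel_left,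
        ← integral_const_mul, ← integral_const_mul, ← integral_add (hi (by fun_prop))
          (hi (by fun_prop))]
      congr 1
      ext x
      ring
    have h2 : ∫ s in (0 : ℝ)..t, γ ^ 2 * r *
        (∫ x in Ioi 0, x ^ 2 * Real.exp (-(2 * γ) * (t - s) * x) ∂μ) * (ψ (max s 0) - P) =
        (∫ s in (0 : ℝ)..t, γ ^ 2 * r * h μ γ 2 (t - s) * ψ s) -
          (∫ s in (0 : ℝ)..t, γ ^ 2 * r * h μ γ 2 (t - s)) * P := by
      have hc : Continuous fun s => γ ^ 2 * r * h μ γ 2 (t - s) := by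
        have := continuous_h hμ γ 2
        fun_prop
      rw [← intervalIntegral.integral_mul_const, ← intervalIntegral.integral_sub]
      · refine intervalIntegral.integral_congr fun s hs => ?_
        rw [uIcc_of_le ht] at hs
        simp only [max_eq_left hs.1, ← h_eq_restrict hμ γ (t - s) two_ne_zero]
        ring
      · refine ContinuousOn.intervalIntegrable_of_Icc ht ?_
        exact hc.continuousOn.mul (hψc.mono Icc_subset_Ici_self)
      · exact (hc.mul continuous_const).intervalIntegrable _ _
    simp only [max_eq_left ht]
    rw [h1, h2, integral_kernel hμ, hψ.equation t ht, forcing]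
    -- The choice of `P` balances the constant terms of the equation.
    have h3 : P * (1 - γ * r / 2 * firstMoment μ) = Rt / 2 * (r * μ.real {0} + (1 - r)) := by
      rw [hP, psiInfty, mul_assoc, div_mul_cancel₀ _ hden]
    linear_combination (-1) * h3

end Volterra

/-! ### Reduction of the moments and sign of `Δ` -/

section Algebra

variable {μ : Measure ℝ} [IsProbabilityMeasure μ] {M lam : ℝ}

lemma measureReal_Ioi_add_atom (hμ : μ (Icc 0 M)ᶜ = 0) : μ.real {0} + μ.real (Ioi 0) = 1 := by
  have := integral_eq_atom_add (f := fun _ => (1 : ℝ)) hμ (integrable_const _)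
  simpa using this.symm

lemma integral_id_div_sub (hne : ∀ᵐ x ∂(μ.restrict (Ioi 0)), x ≠ lam)
    (hint : Integrable (fun x => 1 / (x - lam)) (μ.restrict (Ioi 0))) :
    Integrable (fun x => x / (x - lam)) (μ.restrict (Ioi 0)) ∧
    ∫ x in Ioi 0, x / (x - lam) ∂μ =
      μ.real (Ioi 0) + lam * ∫ x in Ioi 0, 1 / (x - lam) ∂μ := by
  have hae : (fun x => x / (x - lam)) =ᵐ[μ.restrict (Ioi 0)]
      fun x => 1 + lam * (1 / (x - lam)) := by
    filter_upwards [hne] with x hx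
    have := sub_ne_zero.2 hx
    field_simp
    ring
  have hi := (integrable_const (1 : ℝ)).add (hint.const_mul lam)
  refine ⟨hi.congr hae.symm, ?_⟩
  rw [integral_congr_ae hae, integral_add (integrable_const _) (hint.const_mul _),
    integral_const_mul]
  simp

lemma integral_sq_div_sub (hμ : μ (Icc 0 M)ᶜ = 0) (hne : ∀ᵐ x ∂(μ.restrict (Ioi 0)), x ≠ lam)
    (hint : Integrable (fun x => 1 / (x - lam)) (μ.restrict (Ioi 0))) :
    ∫ x in Ioi 0, x ^ 2 / (x - lam) ∂μ =
      firstMoment μ + lam * ∫ x in Ioi 0, x / (x - lam) ∂μ := by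
  have hae : (fun x => x ^ 2 / (x - lam)) =ᵐ[μ.restrict (Ioi 0)]
      fun x => x + lam * (x / (x - lam)) := by
    filter_upwards [hne] with x hx
    have := sub_ne_zero.2 hx
    field_simp
    ring
  have hi : Integrable (fun x : ℝ => x) (μ.restrict (Ioi 0)) :=
    integrable_of_continuousOn (ae_restrict_mem_Icc hμ) continuousOn_id
  rw [integral_congr_ae hae, integral_add hi ((integral_id_div_sub hne hint).1.const_mul _),
    integral_const_mul, firstMoment_eq hμ]

lemma integral_linear_div_sub (hne : ∀ᵐ x ∂(μ.restrict (Ioi 0)), x ≠ lam)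
    (hint : Integrable (fun x => 1 / (x - lam)) (μ.restrict (Ioi 0))) (A B : ℝ) :
    ∫ x in Ioi 0, (A * x + B) / (x - lam) ∂μ =
      A * (∫ x in Ioi 0, x / (x - lam) ∂μ) + B * ∫ x in Ioi 0, 1 / (x - lam) ∂μ := by
  rw [← integral_const_mul, ← integral_const_mul,
    ← integral_add ((integral_id_div_sub hne hint).1.const_mul _) (hint.const_mul _)]
  congr 1
  ext x
  ring

lemma measureReal_Ioi_lt_integral (hedge : 0 < leftEdge μ) (hlam : 0 < lam)
    (hlt : ∀ᵐ x ∂(μ.restrict (Ioi 0)), lam < x)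
    (hint : Integrable (fun x => 1 / (x - lam)) (μ.restrict (Ioi 0))) :
    μ.real (Ioi 0) < ∫ x in Ioi 0, x / (x - lam) ∂μ := by
  rw [(integral_id_div_sub (hlt.mono fun x hx => hx.ne') hint).2]
  have : 0 < ∫ x in Ioi 0, 1 / (x - lam) ∂μ :=
    integral_restrict_pos hedge (hlt.mono fun x hx => one_div_pos.2 (sub_pos.2 hx)) hint
  have := mul_pos hlam this
  linarith

/-- With `n = μ((0, ∞))` and `X = 2/γ - r m`, one has `Δ = RλX + R̃ r (X - λ)`. As `r μ({0}) + 1 - r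
= 1 - r n`, a vanishing limit means `R̃ = 0` or `r n = 1`; in the latter case `hX` gives `X > λ`. -/
lemma signQuantity_pos_of_psiInfty_eq_zero (hμ : μ (Icc 0 M)ᶜ = 0) {r R Rt γ : ℝ} (hr : 0 < r)
    (hR : 0 ≤ R) (hRt : 0 ≤ Rt) (hRRt : 0 < R + Rt) (hlam : 0 < lam)
    (hden : 1 - γ * r / 2 * firstMoment μ ≠ 0)
    (hX : lam * (r * μ.real (Ioi 0)) < 2 / γ - r * firstMoment μ)
    (hpsi : psiInfty μ r Rt γ = 0) : 0 < signQuantity μ r R Rt γ lam := by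
  have hw := measureReal_Ioi_add_atom hμ
  have hn : 0 ≤ μ.real (Ioi 0) := measureReal_nonneg
  rw [signQuantity]
  set X := 2 / γ - r * firstMoment μ
  set n := μ.real (Ioi 0)
  have hX0 : 0 < X := lt_of_le_of_lt (by positivity) hX
  rw [psiInfty, mul_eq_zero, div_eq_zero_iff, div_eq_zero_iff] at hpsi
  have hcase : Rt = 0 ∨ r * n = 1 := by
    rcases hpsi with (h | h) | (h | h)
    · exact Or.inl h
    · norm_num at h
    · right
      linear_combination (-1) * h + r * hw
    · exact absurd h hden
  rcases hcase with h | h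
  · subst h
    have : 0 < R := by linarith
    have : 0 < R * lam * X := by positivity
    linarith
  · rw [h, mul_one] at hX
    have h1 : 0 ≤ R * lam * X := by positivity
    have h2 : 0 ≤ Rt * r * (X - lam) := mul_nonneg (by positivity) (by linarith)
    rcases hR.lt_or_eq with hR' | hR'
    · have : 0 < R * lam * X := by positivity
      linarith
    · have : 0 < Rt := by linarith
      have : 0 < Rt * r * (X - lam) := mul_pos (by positivity) (by linarith)
      linarith

end Algebra

/-! ### The regime `γ > γ_*` -/

section Supercritical

variable {μ : Measure ℝ} [IsProbabilityMeasure μ] {M r R Rt γ lam : ℝ}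

/-- The first form is the one the spectral projection produces, the second displays the sign. Both
come from eliminating `m` through `F(λ) = 2/(γ r)` and the moment relations. -/
lemma supercriticalConst_eq (hμ : μ (Icc 0 M)ᶜ = 0) (hγ : 0 < γ) (hr : 0 < r)
    (hden : 1 - γ * r / 2 * firstMoment μ ≠ 0)
    (h0 : 0 < lam) (hlam : lam < leftEdge μ)
    (hF : ∫ x in Ioi 0, x ^ 2 / (x - lam) ∂μ = 2 / (γ * r)) :
    supercriticalConst μ r R Rt lam =
        2 * (∫ x in Ioi 0, ((R - γ * r * psiInfty μ r Rt γ) / 2 * x + Rt * r / 2) / (x - lam) ∂μ) /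
          (r * ∫ x in Ioi 0, x ^ 2 / (x - lam) ^ 2 ∂μ) ∧
      supercriticalConst μ r R Rt lam = signQuantity μ r R Rt γ lam /
          (r * lam ^ 2 * (r * ∫ x in Ioi 0, x ^ 2 / (x - lam) ^ 2 ∂μ)) := by
  have hne : ∀ᵐ x ∂(μ.restrict (Ioi 0)), x ≠ lam := by
    filter_upwards [ae_restrict_mem_Icc hμ] with x hx using (hlam.trans_le hx.1).ne'
  have hint : Integrable (fun x => 1 / (x - lam)) (μ.restrict (Ioi 0)) :=
    integrable_resolvent_of_lt hμ hlam continuous_const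
  have hw := measureReal_Ioi_add_atom hμ
  have hJ := (integral_id_div_sub hne hint).2
  have hF' := integral_sq_div_sub hμ hne hint
  have hP := integral_eq_atom_add hμ hint
  rw [show 1 / (0 - lam) = -(1 / lam) by rw [zero_sub, div_neg]] at hP
  have hlin := integral_linear_div_sub hne hint ((R - γ * r * psiInfty μ r Rt γ) / 2) (Rt * r / 2)
  rw [hF] at hF'
  have hx1 : ∫ x, x / (x - lam) ∂μ = ∫ x in Ioi 0, x / (x - lam) ∂μ :=
    integral_eq_restrict hμ (by simp)
  have hx2 : ∫ x, x ^ 2 / (x - lam) ^ 2 ∂μ = ∫ x in Ioi 0, x ^ 2 / (x - lam) ^ 2 ∂μ :=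
    integral_eq_restrict hμ (by simp)
  rw [supercriticalConst, hx1, hx2, hP, hlin, signQuantity, psiInfty]
  set J := ∫ x in Ioi 0, x / (x - lam) ∂μ
  set P := ∫ x in Ioi 0, 1 / (x - lam) ∂μ
  set S := ∫ x in Ioi 0, x ^ 2 / (x - lam) ^ 2 ∂μ
  set m := firstMoment μ
  set w := μ.real {0}
  set n := μ.real (Ioi 0)
  have hm : m = 2 / (γ * r) - lam * J := by linarith
  have hw' : w = 1 - n := by linarith
  -- The denominator of `ψ_0(∞)` becomes a multiple of `J`, so that `J` cancels in the term `γ r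
  -- ψ_0(∞) J`.
  have hγm : 1 - γ * r / 2 * m = γ * r / 2 * (lam * J) := by
    rw [hm]; field_simp; ring
  rw [hγm] at hden ⊢
  have hJ0 : J ≠ 0 := fun h => hden (by rw [h]; ring)
  have hnum : R * J + Rt * r * (-(1 / lam) * w + P) - Rt * (1 - r) / lam =
      2 * ((R - γ * r * (Rt / 2 * ((r * w + (1 - r)) / (γ * r / 2 * (lam * J))))) / 2 * J +
        Rt * r / 2 * P) := by
    field_simp
    ring
  refine ⟨by rw [hnum], ?_⟩
  have hsign : (R * lam + Rt * r) * (2 / γ - r * m) - Rt * r * lam =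
      (r * lam ^ 2) * (R * J + Rt * r * (-(1 / lam) * w + P) - Rt * (1 - r) / lam) := by
    rw [hm, hw', hJ]
    field_simp
    ring
  rw [hsign, mul_div_mul_left _ _ (by positivity)]

theorem supercritical_asymptotics (hμ : μ (Icc 0 M)ᶜ = 0) (hedge : 0 < leftEdge μ)
    (hr : 0 < r) (hγ : 0 < γ) {ψ : ℝ → ℝ}
    (hψ : IsVolterraSolution μ r R Rt γ ψ) (h0 : 0 < lam) (hlam : lam < leftEdge μ)
    (hF : ∫ x in Ioi 0, x ^ 2 / (x - lam) ∂μ = 2 / (γ * r))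
    (hden : 1 - γ * r / 2 * firstMoment μ ≠ 0) :
    Tendsto (fun t => Real.exp (2 * γ * lam * t) * (ψ t - psiInfty μ r Rt γ)) atTop
      (𝓝 (supercriticalConst μ r R Rt lam / γ)) := by
  obtain ⟨φ, hφ, hφeq, heq⟩ := hψ.exists_deviation hμ hden
  have hlim := tendsto_exp_mul_of_malthusian (ae_restrict_mem_Icc hμ) hedge
    (g := 2 * γ) (b := γ ^ 2 * r) (by positivity) (by positivity) hlam
    (by rw [hF]; field_simp) (p := fun x => (R - γ * r * psiInfty μ r Rt γ) / 2 * x + Rt * r / 2)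
    (by fun_prop) hφ heq
  have hval : 2 * γ / (γ ^ 2 * r) * ((∫ x in Ioi 0, ((R - γ * r * psiInfty μ r Rt γ) / 2 * x +
      Rt * r / 2) / (x - lam) ∂μ) / ∫ x in Ioi 0, x ^ 2 / (x - lam) ^ 2 ∂μ) =
      supercriticalConst μ r R Rt lam / γ := by
    rw [(supercriticalConst_eq hμ hγ hr hden h0 hlam hF).1]
    field_simp
  rw [hval] at hlim
  refine hlim.congr' ?_
  filter_upwards [eventually_ge_atTop 0] with t ht
  rw [hφeq t ht]

lemma supercriticalConst_pos_iff (hμ : μ (Icc 0 M)ᶜ = 0) (hedge : 0 < leftEdge μ)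
    (hγ : 0 < γ) (hr : 0 < r) (hden : 1 - γ * r / 2 * firstMoment μ ≠ 0)
    (h0 : 0 < lam) (hlam : lam < leftEdge μ)
    (hF : ∫ x in Ioi 0, x ^ 2 / (x - lam) ∂μ = 2 / (γ * r)) :
    0 < supercriticalConst μ r R Rt lam ↔ 0 < signQuantity μ r R Rt γ lam := by
  rw [(supercriticalConst_eq hμ hγ hr hden h0 hlam hF).2]
  have : 0 < ∫ x in Ioi 0, x ^ 2 / (x - lam) ^ 2 ∂μ := by
    refine integral_restrict_pos hedge ?_ (integrable_of_continuousOn (ae_restrict_mem_Icc hμ) ?_)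
    · filter_upwards [ae_restrict_mem_Icc hμ] with x hx
      have h1 : 0 < x - lam := sub_pos.2 (hlam.trans_le hx.1)
      have h2 : 0 < x := hedge.trans_le hx.1
      positivity
    · have : ∀ x ∈ Icc (leftEdge μ) M, (x - lam) ^ 2 ≠ 0 := fun x hx =>
        pow_ne_zero _ (sub_pos.2 (hlam.trans_le hx.1)).ne'
      fun_prop (disch := assumption)
  exact div_pos_iff_of_pos_right (by positivity)

end Supercritical

/-! ### Exponential mixtures tilted at the edge -/

section EdgeKernel

variable {ν : Measure ℝ} [IsFiniteMeasure ν] {e M : ℝ}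

lemma integral_exp_mixture (hν : ∀ᵐ x ∂ν, x ∈ Icc e M) (hlt : ∀ᵐ x ∂ν, e < x) {g : ℝ → ℝ} {c : ℝ}
    (hc : 0 < c) (hg : Continuous g) (hg0 : ∀ᵐ x ∂ν, 0 ≤ g x)
    (hint : Integrable (fun x => g x / (x - e)) ν) :
    IntegrableOn (fun t => ∫ x, g x * Real.exp (-c * t * (x - e)) ∂ν) (Ioi 0) ∧
      ∫ t in Ioi (0 : ℝ), ∫ x, g x * Real.exp (-c * t * (x - e)) ∂ν =
        (∫ x, g x / (x - e) ∂ν) / c := by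
  have hcont : Continuous fun t => ∫ x, g x * Real.exp (-c * t * (x - e)) ∂ν := by
    refine continuous_iff_continuousAt.2 fun t => HasDerivAt.continuousAt
      (hasDerivAt_integral_of_continuousOn hν
        (u := fun t x => g x * Real.exp (-c * t * (x - e)))
        (u' := fun t x => g x * (Real.exp (-c * t * (x - e)) * (-c * (x - e))))
        (by simp only [Function.uncurry_def]; fun_prop)
        (by simp only [Function.uncurry_def]; fun_prop) (fun t x _ => ?_) t)
    have h1 : HasDerivAt (fun t => Real.exp (-c * t * (x - e)))
        (Real.exp (-c * t * (x - e)) * (-c * (x - e))) t := by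
      simpa using (((hasDerivAt_id t).const_mul (-c)).mul_const (x - e)).exp
    exact h1.const_mul (g x)
  have hnn : ∀ t, 0 ≤ ∫ x, g x * Real.exp (-c * t * (x - e)) ∂ν := fun t =>
    integral_nonneg_of_ae (hg0.mono fun x hx => mul_nonneg hx (Real.exp_pos _).le)
  have hdiv : 0 ≤ᵐ[ν] fun x => g x / (x - e) / c := by
    filter_upwards [hg0, hlt] with x h1 h2
    exact div_nonneg (div_nonneg h1 (sub_pos.2 h2).le) hc.le
  have hval : ∫⁻ t in Ioi (0 : ℝ),
      ENNReal.ofReal (∫ x, g x * Real.exp (-c * t * (x - e)) ∂ν) =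
      ENNReal.ofReal ((∫ x, g x / (x - e) ∂ν) / c) := by
    rw [lintegral_exp_mixture hg.measurable hg0
      (fun t _ => integrable_of_continuousOn hν (by fun_prop)), ← integral_div,
      ofReal_integral_eq_lintegral_ofReal (hint.div_const c) hdiv]
    refine lintegral_congr_ae ?_
    filter_upwards [hg0, hlt] with x h1 h2
    have h3 : 0 < c * (x - e) := mul_pos hc (sub_pos.2 h2)
    rw [← ENNReal.ofReal_inv_of_pos h3, ← ENNReal.ofReal_mul h1, div_div, div_eq_mul_inv,
      mul_comm c]
  have hI : IntegrableOn (fun t => ∫ x, g x * Real.exp (-c * t * (x - e)) ∂ν) (Ioi 0) := by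
    refine ⟨hcont.aestronglyMeasurable, ?_⟩
    rw [hasFiniteIntegral_iff_ofReal (Eventually.of_forall hnn), hval]
    exact ENNReal.ofReal_lt_top
  refine ⟨hI, ?_⟩
  rw [integral_eq_lintegral_of_nonneg_ae (Eventually.of_forall hnn) hI.1, hval,
    ENNReal.toReal_ofReal]
  exact div_nonneg (integral_nonneg_of_ae (by
    filter_upwards [hg0, hlt] with x h1 h2 using div_nonneg h1 (sub_pos.2 h2).le)) hc.le

/-- Applying `1 - e^{-y} ≤ y` to `y = cs(x-e)` and absorbing `y` into half of the exponential gives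
`K (t-s) ≤ K t + (2s/(t-s)) K ((t-s)/2)`. For `t ≥ 2s`, doubling twice bounds `K ((t-s)/2)` by `D² K
t`, and the prefactor vanishes. -/
lemma tendsto_shift_ratio {c D : ℝ} (hc : 0 < c) (hν : ∀ᵐ x ∂ν, x ∈ Icc e M) {g : ℝ → ℝ}
    (hg : Continuous g) (hg0 : ∀ᵐ x ∂ν, 0 ≤ g x)
    (hpos : ∀ t, 0 < ∫ x, g x * Real.exp (-c * t * (x - e)) ∂ν)
    (hdbl : ∀ᶠ t : ℝ in atTop, ∫ x, g x * Real.exp (-c * (t / 2) * (x - e)) ∂ν ≤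
      D * ∫ x, g x * Real.exp (-c * t * (x - e)) ∂ν) {s : ℝ} (hs : 0 ≤ s) :
    Tendsto (fun t => (∫ x, g x * Real.exp (-c * (t - s) * (x - e)) ∂ν) /
      ∫ x, g x * Real.exp (-c * t * (x - e)) ∂ν) atTop (𝓝 1) := by
  set K : ℝ → ℝ := fun t => ∫ x, g x * Real.exp (-c * t * (x - e)) ∂ν with hK
  have hi : ∀ t, Integrable (fun x => g x * Real.exp (-c * t * (x - e))) ν := fun t =>
    integrable_of_continuousOn hν (by fun_prop)
  have hanti : Antitone K := by
    intro a b hab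
    refine integral_mono_ae (hi b) (hi a) ?_
    filter_upwards [hν, hg0] with x hx h0
    refine mul_le_mul_of_nonneg_left (Real.exp_le_exp.2 ?_) h0
    have : 0 ≤ (b - a) * (c * (x - e)) :=
      mul_nonneg (sub_nonneg.2 hab) (mul_nonneg hc.le (sub_nonneg.2 hx.1))
    nlinarith
  have hD : 0 ≤ D := by
    obtain ⟨t, ht⟩ := hdbl.exists
    by_contra! h
    have h1 := hpos (t / 2)
    have h2 := mul_neg_of_neg_of_pos h (hpos t)
    linarith
  have hstep : ∀ t, s < t → K (t - s) ≤ K t + 2 * s / (t - s) * K ((t - s) / 2) := by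
    intro t hst
    simp only [hK]
    rw [← integral_const_mul, ← integral_add (hi _) ((hi _).const_mul _)]
    refine integral_mono_ae (hi _) ((hi _).add ((hi _).const_mul _)) ?_
    filter_upwards [hν, hg0] with x hx h0
    have hy : 0 ≤ x - e := sub_nonneg.2 hx.1
    have hts : 0 < t - s := sub_pos.2 hst
    set E := Real.exp (-c * (t - s) * (x - e)) with hE
    have e1 : Real.exp (-c * t * (x - e)) = E * Real.exp (-(c * s * (x - e))) := by
      rw [hE, ← Real.exp_add]; ring_nf
    have e2 : Real.exp (-c * ((t - s) / 2) * (x - e)) =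
        E * Real.exp (c * (t - s) / 2 * (x - e)) := by
      rw [hE, ← Real.exp_add]; ring_nf
    have e3 := Real.add_one_le_exp (-(c * s * (x - e)))
    have e4 : c * (t - s) / 2 * (x - e) ≤ Real.exp (c * (t - s) / 2 * (x - e)) := by
      linarith [Real.add_one_le_exp (c * (t - s) / 2 * (x - e))]
    have e5 : c * s * (x - e) ≤ 2 * s / (t - s) * Real.exp (c * (t - s) / 2 * (x - e)) := by
      have := mul_le_mul_of_nonneg_left e4 (by positivity : 0 ≤ 2 * s / (t - s))
      refine le_trans (le_of_eq ?_) this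
      field_simp
    have hE0 : 0 ≤ g x * E := mul_nonneg h0 (Real.exp_pos _).le
    have e6 : (1 : ℝ) ≤ Real.exp (-(c * s * (x - e))) +
        2 * s / (t - s) * Real.exp (c * (t - s) / 2 * (x - e)) := by linarith
    have := mul_le_mul_of_nonneg_left e6 hE0
    rw [e1, e2]
    linarith
  have hlim : Tendsto (fun t => 1 + 2 * s / (t - s) * (D * D)) atTop (𝓝 (1 + 0 * (D * D))) := by
    refine Tendsto.const_add _ (Tendsto.mul_const _ ?_)
    exact (tendsto_atTop_add_const_right _ (-s) tendsto_id).const_div_atTop (2 * s)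
  rw [zero_mul, add_zero] at hlim
  refine tendsto_of_tendsto_of_tendsto_of_le_of_le' tendsto_const_nhds hlim ?_ ?_
  · exact Eventually.of_forall fun t => (one_le_div (hpos t)).2 (hanti (by linarith))
  · have hdbl2 := (tendsto_id.atTop_div_const (by norm_num : (0 : ℝ) < 2)).eventually hdbl
    filter_upwards [hdbl, hdbl2, eventually_gt_atTop s, eventually_ge_atTop (2 * s)]
      with t h1 h2 h3 h4
    rw [div_le_iff₀ (hpos t)]
    have hts : 0 < t - s := sub_pos.2 h3
    have h5 : K ((t - s) / 2) ≤ K (t / 2 / 2) := hanti (by linarith)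
    have h6 : K (t / 2 / 2) ≤ D * K (t / 2) := h2
    have h7 : D * K (t / 2) ≤ D * (D * K t) := mul_le_mul_of_nonneg_left h1 hD
    have h8 := mul_le_mul_of_nonneg_left (h5.trans (h6.trans h7))
      (by positivity : 0 ≤ 2 * s / (t - s))
    refine (hstep t h3).trans ?_
    change _ ≤ _ * K t
    linarith

end EdgeKernel

/-! ### Finiteness and regular variation at the edge -/

section Subcritical

variable {μ : Measure ℝ} {M r R Rt γ : ℝ}

/-- An atom at the edge would make the integral infinite, and `x ≥ e > 0` gives `1/(x-e) ≤ e⁻²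
x²/(x-e)`. -/
lemma subcritical_edge (hμ : μ (Icc 0 M)ᶜ = 0) (hedge : 0 < leftEdge μ)
    (hfin : resolventIntegral μ (leftEdge μ) ≠ ⊤) :
    (∀ᵐ x ∂(μ.restrict (Ioi 0)), leftEdge μ < x) ∧
      Integrable (fun x => x ^ 2 / (x - leftEdge μ)) (μ.restrict (Ioi 0)) ∧
      Integrable (fun x => 1 / (x - leftEdge μ)) (μ.restrict (Ioi 0)) := by
  rw [resolventIntegral_eq_restrict hμ] at hfin
  have hlt : ∀ᵐ x ∂(μ.restrict (Ioi 0)), leftEdge μ < x := by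
    filter_upwards [ae_lt_top (by fun_prop) hfin, ae_restrict_mem_Icc hμ] with x h1 h2
    refine lt_of_le_of_ne h2.1 fun h => ?_
    rw [← h, sub_self, ENNReal.ofReal_zero, ENNReal.div_zero (by positivity)] at h1
    exact h1.false
  have hint : Integrable (fun x => x ^ 2 / (x - leftEdge μ)) (μ.restrict (Ioi 0)) := by
    refine ⟨(by fun_prop : Measurable _).aestronglyMeasurable, ?_⟩
    rw [hasFiniteIntegral_iff_ofReal]
    · refine lt_of_le_of_lt (le_of_eq (lintegral_congr_ae ?_)) hfin.lt_top
      filter_upwards [hlt] with x hx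
      rw [ENNReal.ofReal_div_of_pos (sub_pos.2 hx)]
    · filter_upwards [hlt] with x hx using div_nonneg (sq_nonneg _) (sub_pos.2 hx).le
  refine ⟨hlt, hint, ?_⟩
  refine (hint.const_mul (1 / leftEdge μ ^ 2)).mono'
    (by fun_prop : Measurable _).aestronglyMeasurable ?_
  filter_upwards [hlt] with x hx
  have h1 : 0 < x - leftEdge μ := sub_pos.2 hx
  rw [Real.norm_of_nonneg (by positivity), ← mul_div_assoc]
  gcongr
  rw [one_div_mul_eq_div, one_le_div (by positivity)]
  gcongr

lemma measureReal_map_sub_Iic (hlt : ∀ᵐ x ∂(μ.restrict (Ioi 0)), leftEdge μ < x)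
    (hedge : 0 < leftEdge μ) (s : ℝ) :
    ((μ.restrict (Ioi 0)).map (fun x => x - leftEdge μ)).real (Iic s) =
      μ.real (Ioc (leftEdge μ) (leftEdge μ + s)) := by
  rw [map_measureReal_apply (by fun_prop) measurableSet_Iic]
  have h1 : ((fun x => x - leftEdge μ) ⁻¹' Iic s : Set ℝ) =ᵐ[μ.restrict (Ioi 0)]
      (Ioc (leftEdge μ) (leftEdge μ + s) : Set ℝ) := by
    filter_upwards [hlt] with x hx
    refine propext ?_
    change x - leftEdge μ ≤ s ↔ leftEdge μ < x ∧ x ≤ leftEdge μ + s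
    exact ⟨fun h => ⟨hx, by linarith⟩, fun h => by linarith [h.2]⟩
  rw [measureReal_congr h1, measureReal_restrict_apply measurableSet_Ioc]
  congr 1
  exact inter_eq_left.2 fun x hx => hedge.trans hx.1

lemma measureReal_Ioc_leftEdge_pos [IsFiniteMeasure μ]
    (hlt : ∀ᵐ x ∂(μ.restrict (Ioi 0)), leftEdge μ < x)
    (hedge : 0 < leftEdge μ) {s : ℝ} (hs : 0 < s) :
    0 < μ.real (Ioc (leftEdge μ) (leftEdge μ + s)) := by
  rw [← measureReal_map_sub_Iic hlt hedge, map_measureReal_apply (by fun_prop) measurableSet_Iic]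
  refine ENNReal.toReal_pos ?_ (measure_ne_top _ _)
  refine ((measure_Ioo_leftEdge_pos hedge hs).trans_le (measure_mono fun x hx => ?_)).ne'
  change x - leftEdge μ ≤ s
  linarith [hx.2]

/-- Left-edge regularity in terms of ratios, along the parameter `θ = 1 / t`. -/
lemma IsLeftEdgeRegular.tendsto_ratio {α : ℝ} {L : ℝ → ℝ} (hL : IsLeftEdgeRegular μ α L)
    (hpos : ∀ s, 0 < s → 0 < μ.real (Ioc (leftEdge μ) (leftEdge μ + s))) :
    Tendsto (fun θ : ℝ => μ.real (Ioc (leftEdge μ) (leftEdge μ + 1 / θ)) / (θ ^ (-α) * L θ))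
      atTop (𝓝 1) ∧
    ∀ c, 0 < c → Tendsto (fun θ : ℝ => μ.real (Ioc (leftEdge μ) (leftEdge μ + c / θ)) /
      μ.real (Ioc (leftEdge μ) (leftEdge μ + 1 / θ))) atTop (𝓝 (c ^ α)) := by
  obtain ⟨hα, hslow, hequiv⟩ := hL
  set U : ℝ → ℝ := fun s => μ.real (Ioc (leftEdge μ) (leftEdge μ + s)) with hU
  obtain ⟨w, hw, hUw⟩ := hequiv.exists_eq_mul
  have hratio : Tendsto (fun s : ℝ => U s / (s ^ α * L (1 / s))) (𝓝[>] 0) (𝓝 1) := by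
    refine hw.congr' ?_
    filter_upwards [hUw, self_mem_nhdsWithin] with s hs hs0
    have h1 : U s = w s * (s ^ α * L (1 / s)) := hs
    -- `L` is not assumed nonzero; positivity of the mass near the edge forces this wherever the
    -- equivalence factorises.
    have h2 : s ^ α * L (1 / s) ≠ 0 := fun h => by
      rw [h, mul_zero] at h1
      exact (hpos s hs0).ne' h1
    rw [h1, mul_div_cancel_right₀ _ h2]
  have hto : ∀ c : ℝ, 0 < c → Tendsto (fun θ : ℝ => c / θ) atTop (𝓝[>] 0) := by
    intro c hc
    refine tendsto_nhdsWithin_iff.2 ⟨tendsto_id.const_div_atTop c, ?_⟩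
    filter_upwards [eventually_gt_atTop 0] with θ hθ using div_pos hc hθ
  have hcθ : ∀ c, 0 < c → Tendsto (fun θ : ℝ => U (c / θ) / ((c / θ) ^ α * L (θ / c)))
      atTop (𝓝 1) := by
    intro c hc
    have := hratio.comp (hto c hc)
    simpa only [Function.comp_def, one_div_div] using this
  have h1 : Tendsto (fun θ : ℝ => U (1 / θ) / (θ ^ (-α) * L θ)) atTop (𝓝 1) := by
    refine (hcθ 1 one_pos).congr' ?_
    filter_upwards [eventually_gt_atTop 0] with θ hθ
    rw [div_one, one_div, Real.inv_rpow hθ.le, Real.rpow_neg hθ.le]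
  refine ⟨h1, fun c hc => ?_⟩
  -- Slow variation enters at `c⁻¹`, since the mass at scale `c/θ` involves `L (θ/c)`.
  have h2 := ((hcθ c hc).div h1 one_ne_zero).mul
    ((hslow c⁻¹ (inv_pos.2 hc)).const_mul (c ^ α))
  rw [div_one, one_mul, mul_one] at h2
  refine h2.congr' ?_
  filter_upwards [eventually_gt_atTop 0, (hcθ c hc).eventually_ne one_ne_zero,
    h1.eventually_ne one_ne_zero] with θ hθ hn1 hn2
  obtain ⟨n1, n2⟩ := div_ne_zero_iff.1 hn1
  obtain ⟨n3, n4⟩ := div_ne_zero_iff.1 hn2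
  obtain ⟨-, n5⟩ := mul_ne_zero_iff.1 n2
  obtain ⟨-, n6⟩ := mul_ne_zero_iff.1 n4
  have hp := (Real.rpow_pos_of_pos hθ α).ne'
  have hcp := (Real.rpow_pos_of_pos hc α).ne'
  simp only [Pi.div_apply]
  rw [Real.div_rpow hc.le hθ.le, Real.rpow_neg hθ.le, ← div_eq_mul_inv]
  change _ = U (c / θ) / U (1 / θ)
  field_simp

end Subcritical

/-! ### The regime `γ < γ_*` -/

section Subcritical

variable {μ : Measure ℝ} {M r R Rt γ : ℝ}

/-- Edge asymptotics of Laplace-type integrals with a weight that is Lipschitz at the edge. -/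
lemma tendsto_edge_laplace_div [IsFiniteMeasure μ] (hμ : μ (Icc 0 M)ᶜ = 0)
    (hedge : 0 < leftEdge μ) (hlt : ∀ᵐ x ∂(μ.restrict (Ioi 0)), leftEdge μ < x)
    {α C : ℝ} (hα : 0 < α)
    (hrv : ∀ c, 0 < c → Tendsto (fun θ : ℝ => μ.real (Ioc (leftEdge μ) (leftEdge μ + c / θ)) /
      μ.real (Ioc (leftEdge μ) (leftEdge μ + 1 / θ))) atTop (𝓝 (c ^ α)))
    {g : ℝ → ℝ} (hg : Continuous g)
    (hgC : ∀ᵐ x ∂(μ.restrict (Ioi 0)), |g x - g (leftEdge μ)| ≤ C * (x - leftEdge μ)) :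
    Tendsto (fun θ : ℝ => (∫ x in Ioi 0, g x * Real.exp (-θ * (x - leftEdge μ)) ∂μ) /
      μ.real (Ioc (leftEdge μ) (leftEdge μ + 1 / θ))) atTop
      (𝓝 (g (leftEdge μ) * Real.Gamma (α + 1))) := by
  set e := leftEdge μ
  have hmeas : Measurable fun x : ℝ => x - e := by fun_prop
  set ν := (μ.restrict (Ioi 0)).map (fun x => x - e) with hν
  have hU : ∀ s, ν.real (Iic s) = μ.real (Ioc e (e + s)) := measureReal_map_sub_Iic hlt hedge
  have hν0 : ∀ᵐ y ∂ν, 0 < y := by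
    rw [hν, ae_map_iff hmeas.aemeasurable measurableSet_Ioi]
    filter_upwards [hlt] with x hx using sub_pos.2 hx
  have hνC : ∀ᵐ y ∂ν, |g (y + e) - g e| ≤ C * y := by
    rw [hν, ae_map_iff hmeas.aemeasurable (measurableSet_le (by fun_prop) (by fun_prop))]
    filter_upwards [hgC] with x hx
    rwa [sub_add_cancel]
  have hνpos : ∀ s, 0 < s → 0 < ν.real (Iic s) := fun s hs => by
    rw [hU]; exact measureReal_Ioc_leftEdge_pos hlt hedge hs
  have hνrv : ∀ c, 0 < c → Tendsto (fun θ : ℝ => ν.real (Iic (c / θ)) / ν.real (Iic (1 / θ)))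
      atTop (𝓝 (c ^ α)) := by
    simpa only [hU] using hrv
  have h1 := ((tendsto_integral_exp_div hα hν0 hνpos hνrv).const_mul (g e)).add
    (tendsto_integral_mul_exp_div (g := fun y => g (y + e) - g e) hα hν0 hνpos hνrv hνC)
  rw [add_zero] at h1
  refine h1.congr fun θ => ?_
  have hi := fun {f : ℝ → ℝ} (hf : Continuous f) =>
      integrable_of_continuousOn (ae_restrict_mem_Icc hμ) hf.continuousOn
  rw [hU, ← mul_div_assoc, ← add_div]
  congr 1
  rw [hν, integral_map hmeas.aemeasurable (by fun_prop),
    integral_map hmeas.aemeasurable (by fun_prop), ← integral_const_mul,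
    ← integral_add (hi (by fun_prop)) (hi (by fun_prop))]
  congr 1
  ext x
  rw [sub_add_cancel]
  ring

/-- With `P = ∫ 1/(x-e)`, the moment relations turn `n + eP` into `∫ x/(x-e)` and `m + e(n + eP)`
into `F(e)`. The right side is then the numerator of the renewal limit times `g(e) = γ² r e²`, over
the denominator `(1 - γ/γ_*)²`. -/
lemma signQuantity_eq_of_edge {e A B P n w m psi : ℝ} (hγ : 0 < γ)
    (hr : 0 < r) (hn : w + n = 1)
    (hpsi : psi * (1 - γ * r / 2 * m) = Rt / 2 * (r * w + (1 - r)))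
    (hA : A = (R - γ * r * psi) / 2) (hB : B = Rt * r / 2) :
    γ * ((R * e + Rt * r) * (2 / γ - r * m) - Rt * r * e) / 4 =
      (A * e + B) * (1 - γ * r / 2 * (m + e * (n + e * P))) +
        γ ^ 2 * r * e ^ 2 * ((A * (n + e * P) + B * P) / (2 * γ)) := by
  have hw : w = 1 - n := by linarith
  subst hA hB hw
  have h1 : γ * ((R * e + Rt * r) * (2 / γ - r * m) - Rt * r * e) =
      (R * e + Rt * r) * (2 - γ * r * m) - γ * Rt * r * e := by field_simp
  have h2 : γ ^ 2 * r * e ^ 2 * (((R - γ * r * psi) / 2 * (n + e * P) + Rt * r / 2 * P) / (2 * γ)) =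
      γ * r * e ^ 2 / 2 * ((R - γ * r * psi) / 2 * (n + e * P) + Rt * r / 2 * P) := by
    field_simp
  rw [h1, h2]
  linear_combination (γ * r * e / 2) * hpsi

lemma div_criticalStepsize_eq (hμ : μ (Icc 0 M)ᶜ = 0)
    (hr : 0 < r) (hlt : ∀ᵐ x ∂(μ.restrict (Ioi 0)), leftEdge μ < x)
    (hint : Integrable (fun x => x ^ 2 / (x - leftEdge μ)) (μ.restrict (Ioi 0))) :
    γ / criticalStepsize μ r =
      γ * r / 2 * ∫ x in Ioi 0, x ^ 2 / (x - leftEdge μ) ∂μ := by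
  have h0 : 0 ≤ ∫ x in Ioi 0, x ^ 2 / (x - leftEdge μ) ∂μ := by
    refine integral_nonneg_of_ae ?_
    filter_upwards [hlt] with x hx using div_nonneg (sq_nonneg _) (sub_pos.2 hx).le
  rw [criticalStepsize, resolventIntegral_eq_ofReal hμ hlt hint,
    ← ENNReal.ofReal_mul (by positivity), ENNReal.toReal_inv,
    ENNReal.toReal_ofReal (by positivity), div_inv_eq_mul]
  ring

theorem subcritical_asymptotics [IsProbabilityMeasure μ] (hμ : μ (Icc 0 M)ᶜ = 0)
    (hedge : 0 < leftEdge μ) (hr : 0 < r) (hγ : 0 < γ) {ψ : ℝ → ℝ}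
    (hψ : IsVolterraSolution μ r R Rt γ ψ)
    (hlt : ∀ᵐ x ∂(μ.restrict (Ioi 0)), leftEdge μ < x)
    (hint2 : Integrable (fun x => x ^ 2 / (x - leftEdge μ)) (μ.restrict (Ioi 0)))
    (hint0 : Integrable (fun x => 1 / (x - leftEdge μ)) (μ.restrict (Ioi 0)))
    (hden : 1 - γ * r / 2 * firstMoment μ ≠ 0)
    (hI : γ * r / 2 * (∫ x in Ioi 0, x ^ 2 / (x - leftEdge μ) ∂μ) < 1)
    {α : ℝ} {L : ℝ → ℝ} (hL : IsLeftEdgeRegular μ α L) :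
    Tendsto (fun t => Real.exp (2 * γ * leftEdge μ * t) * (ψ t - psiInfty μ r Rt γ) /
      (t ^ (-α) * L t)) atTop (𝓝 (subcriticalConst μ r R Rt γ α)) := by
  obtain ⟨φ, hφ, hφeq, heq⟩ := hψ.exists_deviation hμ hden
  have hα : 0 < α := hL.1
  have hcrit := div_criticalStepsize_eq (γ := γ) hμ hr hlt hint2
  have hUpos := fun s (hs : 0 < s) => measureReal_Ioc_leftEdge_pos hlt hedge hs
  obtain ⟨hUL, hrv⟩ := hL.tendsto_ratio hUpos
  have hne : ∀ᵐ x ∂(μ.restrict (Ioi 0)), x ≠ leftEdge μ := hlt.mono fun x hx => hx.ne'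
  have hJ := integral_id_div_sub hne hint0
  have hF := integral_sq_div_sub hμ hne hint0
  have hw := measureReal_Ioi_add_atom hμ
  have hM := ae_restrict_mem_Icc hμ
  have hpsi : psiInfty μ r Rt γ * (1 - γ * r / 2 * firstMoment μ) =
      Rt / 2 * (r * μ.real {0} + (1 - r)) := by
    rw [psiInfty, mul_assoc, div_mul_cancel₀ _ hden]
  rw [subcriticalConst, signQuantity, hcrit]
  set e := leftEdge μ
  set A := (R - γ * r * psiInfty μ r Rt γ) / 2 with hA
  set B := Rt * r / 2 with hB
  set c := 2 * γ with hc
  have hc0 : 0 < c := by positivity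
  set U : ℝ → ℝ := fun θ => μ.real (Ioc e (e + 1 / θ)) with hU
  have hi := fun {f : ℝ → ℝ} (hf : Continuous f) =>
      integrable_of_continuousOn hM hf.continuousOn
  -- the kernel and the forcing term
  set g : ℝ → ℝ := fun x => γ ^ 2 * r * x ^ 2 with hg
  have hgc : Continuous g := by fun_prop
  have hg0 : ∀ x, 0 ≤ g x := fun x => by positivity
  set K : ℝ → ℝ := fun t => ∫ x in Ioi 0, g x * Real.exp (-c * t * (x - e)) ∂μ with hK
  set f : ℝ → ℝ := fun t => ∫ x in Ioi 0, (A * x + B) * Real.exp (-c * t * (x - e)) ∂μ with hf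
  have hKpos : ∀ t, 0 < K t := fun t => by
    refine integral_restrict_pos hedge ?_ (hi (by fun_prop))
    filter_upwards [hlt] with x hx
    have : 0 < x := hedge.trans hx
    positivity
  have hKc : Continuous K := by
    have hmul : ∀ t, K t = γ ^ 2 * r * (Real.exp (c * e * t) * h μ γ 2 t) := fun t => by
      simp only [hK]
      rw [h_eq_restrict hμ γ t two_ne_zero, ← integral_const_mul, ← integral_const_mul]
      congr 1
      ext x
      rw [show -c * t * (x - e) = c * e * t + -(2 * γ) * t * x by rw [hc]; ring, Real.exp_add]
      ring
    rw [funext hmul]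
    have := continuous_h hμ γ 2
    fun_prop
  have hKanti : AntitoneOn K (Ici 0) := by
    intro a _ b _ hab
    refine integral_mono_ae (hi (by fun_prop)) (hi (by fun_prop)) ?_
    filter_upwards [hM] with x hx
    refine mul_le_mul_of_nonneg_left (Real.exp_le_exp.2 ?_) (hg0 x)
    have : 0 ≤ (b - a) * (c * (x - e)) :=
      mul_nonneg (sub_nonneg.2 hab) (mul_nonneg hc0.le (sub_nonneg.2 hx.1))
    nlinarith
  have hKmix := integral_exp_mixture hM hlt hc0 hgc (Eventually.of_forall hg0)
    (by simpa only [hg, mul_div_assoc] using hint2.const_mul (γ ^ 2 * r))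
  have hKval : ∫ t in Ioi 0, K t = γ * r / 2 * ∫ x in Ioi 0, x ^ 2 / (x - e) ∂μ := by
    rw [hK, hKmix.2]
    simp only [hg, mul_div_assoc (γ ^ 2 * r)]
    rw [integral_const_mul, hc]
    field_simp
  have hx0 : ∀ᵐ x ∂(μ.restrict (Ioi 0)), 0 ≤ x := hlt.mono fun x hx => (hedge.trans hx).le
  have hf1 := integral_exp_mixture hM hlt hc0 continuous_id hx0 hJ.1
  have hf0 := integral_exp_mixture hM hlt hc0 (g := fun _ => (1 : ℝ)) continuous_const
    (Eventually.of_forall fun x => zero_le_one) hint0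
  have hfeq : f = fun t => A * (∫ x in Ioi 0, id x * Real.exp (-c * t * (x - e)) ∂μ) +
      B * ∫ x in Ioi 0, 1 * Real.exp (-c * t * (x - e)) ∂μ := by
    ext t
    simp only [hf]
    rw [← integral_const_mul, ← integral_const_mul, ← integral_add
      (hi (by fun_prop)) (hi (by fun_prop))]
    congr 1
    ext x
    simp only [id]
    ring
  have hfint : IntegrableOn f (Ioi 0) := by
    rw [hfeq]
    exact (hf1.1.const_mul A).add (hf0.1.const_mul B)
  have hfval : ∫ t in Ioi 0, f t =
      (A * (∫ x in Ioi 0, x / (x - e) ∂μ) + B * ∫ x in Ioi 0, 1 / (x - e) ∂μ) / c := by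
    rw [hfeq, integral_add (hf1.1.const_mul A) (hf0.1.const_mul B), integral_const_mul,
      integral_const_mul, hf1.2, hf0.2]
    simp only [id]
    ring
  -- edge asymptotics
  have hct : Tendsto (fun t : ℝ => c * t) atTop atTop := tendsto_id.const_mul_atTop hc0
  have hKU : Tendsto (fun t => K t / U (c * t)) atTop (𝓝 (g e * Real.Gamma (α + 1))) := by
    have := (tendsto_edge_laplace_div hμ hedge hlt hα hrv hgc (C := γ ^ 2 * r * (M + e)) (by
      filter_upwards [hM] with x hx
      have h1 : 0 ≤ x - e := sub_nonneg.2 hx.1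
      have h2 : 0 < x := hedge.trans_le hx.1
      rw [show g x - g e = γ ^ 2 * r * (x + e) * (x - e) by simp only [hg]; ring,
        abs_of_nonneg (by positivity)]
      gcongr
      exact hx.2)).comp hct
    refine this.congr fun t => ?_
    simp only [Function.comp_def, hK, hU, neg_mul, e]
  have hfU : Tendsto (fun t => f t / U (c * t)) atTop
      (𝓝 ((A * e + B) * Real.Gamma (α + 1))) := by
    have := (tendsto_edge_laplace_div hμ hedge hlt hα hrv (g := fun x => A * x + B) (by fun_prop)
      (C := |A|) (by
      filter_upwards [hM] with x hx
      have h1 : 0 ≤ x - e := sub_nonneg.2 hx.1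
      rw [show A * x + B - (A * e + B) = A * (x - e) by ring, abs_mul, abs_of_nonneg h1])).comp hct
    refine this.congr fun t => ?_
    simp only [Function.comp_def, hf, hU, neg_mul, e]
  have hΓ : 0 < Real.Gamma (α + 1) := Real.Gamma_pos_of_pos (by linarith)
  have hge : 0 < g e := by positivity
  have hUc : ∀ t, 0 < t → U t ≠ 0 := fun t ht => (hUpos (1 / t) (by positivity)).ne'
  have hfK : Tendsto (fun t => f t / K t) atTop (𝓝 ((A * e + B) / g e)) := by
    have h1 := hfU.div hKU (by positivity)
    rw [mul_div_mul_right _ _ hΓ.ne'] at h1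
    refine h1.congr' ?_
    filter_upwards [eventually_gt_atTop 0] with t ht
    exact div_div_div_cancel_right₀ (hUc _ (mul_pos hc0 ht)) _ _
  -- The ratio tends to `2 ^ α`, so any larger constant would do.
  have hdbl : ∀ᶠ t in atTop, K (t / 2) ≤ (2 ^ α + 1) * K t := by
    have h1 := hKU.comp (tendsto_id.atTop_div_const (by norm_num : (0 : ℝ) < 2))
    have h2 := ((h1.mul ((hrv 2 (by norm_num)).comp hct)).div hKU (by positivity))
    have hlim : g e * Real.Gamma (α + 1) * 2 ^ α / (g e * Real.Gamma (α + 1)) = 2 ^ α :=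
      mul_div_cancel_left₀ _ (by positivity)
    rw [hlim] at h2
    filter_upwards [h2.eventually (eventually_lt_nhds (lt_add_one _)), eventually_gt_atTop 0]
      with t ht ht0
    have n1 : U (c * t) ≠ 0 := hUc _ (by positivity)
    have n2 : U (c * (t / 2)) ≠ 0 := hUc _ (by positivity)
    have n3 : μ.real (Ioc e (e + 2 / (c * t))) = U (c * (t / 2)) := by
      simp only [hU]
      rw [show 2 / (c * t) = 1 / (c * (t / 2)) by field_simp]
    simp only [Function.comp_def, Pi.div_apply, id, n3] at ht
    change K (t / 2) / U (c * (t / 2)) * (U (c * (t / 2)) / U (c * t)) / (K t / U (c * t)) < _ at ht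
    rw [div_mul_div_cancel₀ n2, div_div_div_cancel_right₀ n1, div_lt_iff₀ (hKpos t)] at ht
    exact ht.le
  have hlong : ∀ s, 0 ≤ s → Tendsto (fun t => K (t - s) / K t) atTop (𝓝 1) := fun s hs =>
    tendsto_shift_ratio hc0 hM hgc (Eventually.of_forall hg0) hKpos hdbl hs
  set a : ℝ → ℝ := fun t => Real.exp (c * e * t) * φ t with ha
  have haeq : ∀ t, 0 ≤ t → a t = f t + ∫ s in (0 : ℝ)..t, K (t - s) * a s := by
    intro t ht
    simp only [ha]
    rw [heq t ht, mul_add, ← integral_const_mul, ← intervalIntegral.integral_const_mul]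
    congr 1
    · congr 1
      ext x
      rw [show -c * t * (x - e) = c * e * t + -c * t * x by ring, Real.exp_add]
      ring
    · refine intervalIntegral.integral_congr fun s _ => ?_
      have h1 : K (t - s) = γ ^ 2 * r * (Real.exp (c * e * (t - s)) *
          ∫ x in Ioi 0, x ^ 2 * Real.exp (-c * (t - s) * x) ∂μ) := by
        simp only [hK]
        rw [← integral_const_mul, ← integral_const_mul]
        congr 1
        ext x
        rw [show -c * (t - s) * (x - e) = c * e * (t - s) + -c * (t - s) * x by ring,
          Real.exp_add]
        ring
      have h2 : Real.exp (c * e * t) = Real.exp (c * e * (t - s)) * Real.exp (c * e * s) := by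
        rw [← Real.exp_add]; ring_nf
      simp only [h1, h2]
      ring
  have hI' : ∫ t in Ioi 0, K t < 1 := by rw [hKval]; exact hI
  have hmain := tendsto_renewal_div_kernel hKc (fun t _ => hKpos t) hKanti hKmix.1 hI' hlong hdbl
    hfint hfK (by fun_prop) haeq
  -- Passing from scale `1/(2γt)` to `1/t` produces the factor `(2γ)^{-α}` of `κ`.
  have hUt : Tendsto (fun t => U (c * t) / U t) atTop (𝓝 ((1 / c) ^ α)) := by
    refine (hrv (1 / c) (by positivity)).congr fun t => ?_
    simp only [hU]
    rw [div_div]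
  have hfinal := ((hmain.mul hKU).mul hUt).mul hUL
  rw [hKval, hfval] at hfinal
  have hconst : γ * Real.Gamma (α + 1) *
      ((R * e + Rt * r) * (2 / γ - r * firstMoment μ) - Rt * r * e) /
        (4 * c ^ α * (1 - γ * r / 2 * ∫ x in Ioi 0, x ^ 2 / (x - e) ∂μ) ^ 2) =
      ((A * e + B) / g e +
        (A * (∫ x in Ioi 0, x / (x - e) ∂μ) + B * ∫ x in Ioi 0, 1 / (x - e) ∂μ) / c /
          (1 - γ * r / 2 * ∫ x in Ioi 0, x ^ 2 / (x - e) ∂μ)) /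
        (1 - γ * r / 2 * ∫ x in Ioi 0, x ^ 2 / (x - e) ∂μ) *
        (g e * Real.Gamma (α + 1)) * (1 / c) ^ α * 1 := by
    have hq := signQuantity_eq_of_edge (e := e) (P := ∫ x in Ioi 0, 1 / (x - e) ∂μ) (R := R)
      hγ hr hw hpsi hA hB
    rw [← hJ.2, ← hF] at hq
    have hD : 1 - γ * r / 2 * (∫ x in Ioi 0, x ^ 2 / (x - e) ∂μ) ≠ 0 := by
      have := sub_pos.2 hI
      exact this.ne'
    rw [one_div, Real.inv_rpow hc0.le]
    have hcα : c ^ α ≠ 0 := (Real.rpow_pos_of_pos hc0 α).ne'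
    have hgee : γ ^ 2 * r * e ^ 2 = g e := rfl
    rw [hgee] at hq
    set D := 1 - γ * r / 2 * ∫ x in Ioi 0, x ^ 2 / (x - e) ∂μ
    set N := A * (∫ x in Ioi 0, x / (x - e) ∂μ) + B * ∫ x in Ioi 0, 1 / (x - e) ∂μ
    have hrw : ((A * e + B) / g e + N / c / D) / D * (g e * Real.Gamma (α + 1)) * (c ^ α)⁻¹ * 1 =
        ((A * e + B) * D + g e * (N / c)) * Real.Gamma (α + 1) / (c ^ α * D ^ 2) := by
      field_simp
    rw [hrw, ← hq]
    field_simp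
  rw [hconst]
  refine hfinal.congr' ?_
  filter_upwards [eventually_gt_atTop 0] with t ht
  have n1 : U (c * t) ≠ 0 := hUc _ (by positivity)
  have n2 : U t ≠ 0 := hUc _ ht
  have n3 := (hKpos t).ne'
  change a t / K t * (K t / U (c * t)) * (U (c * t) / U t) * (U t / (t ^ (-α) * L t)) = _
  rw [div_mul_div_cancel₀ n3, div_mul_div_cancel₀ n1, div_mul_div_cancel₀ n2]
  simp only [ha]
  rw [hφeq t ht.le]

end Subcritical

/-! ### Assembly of the two regimes -/

lemma IsSlowlyVarying.const_mul {L : ℝ → ℝ} (hL : IsSlowlyVarying L) {κ : ℝ} (hκ : κ ≠ 0) :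
    IsSlowlyVarying fun t => κ * L t := fun x hx =>
  (hL x hx).congr fun _ => (mul_div_mul_left _ _ hκ).symm

end SGDVolterra

open SGDVolterra

theorem theorem2 (μ : Measure ℝ) [IsProbabilityMeasure μ]
    (hμ : ∃ M : ℝ, μ (Icc 0 M)ᶜ = 0) (hedge : 0 < SGDVolterra.leftEdge μ)
    (r R Rt γ : ℝ) (hr : 0 < r) (hR : 0 ≤ R) (hRt : 0 ≤ Rt) (hRRt : 0 < R + Rt) (hγ : 0 < γ)
    (ψ : ℝ → ℝ) (hψ : SGDVolterra.IsVolterraSolution μ r R Rt γ ψ) :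
    (SGDVolterra.criticalStepsize μ r < γ → γ < SGDVolterra.maxStepsize μ r →
      (∃! lam : ℝ, SGDVolterra.IsMalthusianExponent μ r γ lam) ∧
      ∀ lam : ℝ, SGDVolterra.IsMalthusianExponent μ r γ lam →
        (0 < lam ∧ lam < SGDVolterra.leftEdge μ) ∧
        (∀ lam' ≤ SGDVolterra.leftEdge μ,
          ENNReal.ofReal (r / 2) * SGDVolterra.resolventIntegral μ lam' = ENNReal.ofReal (1 / γ) ↔
            lam' = lam) ∧
        Tendsto
          (fun t => Real.exp (2 * γ * lam * t) * (ψ t - SGDVolterra.psiInfty μ r Rt γ))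
          atTop (𝓝 (SGDVolterra.supercriticalConst μ r R Rt lam / γ)) ∧
        (SGDVolterra.supercriticalConst μ r R Rt lam ≠ 0 →
          (fun t => ψ t - SGDVolterra.psiInfty μ r Rt γ) ~[atTop]
            (fun t => SGDVolterra.supercriticalConst μ r R Rt lam / γ *
              Real.exp (-2 * γ * lam * t))) ∧
        (0 < SGDVolterra.supercriticalConst μ r R Rt lam ↔
          0 < SGDVolterra.signQuantity μ r R Rt γ lam) ∧
        (SGDVolterra.psiInfty μ r Rt γ = 0 →
          0 < SGDVolterra.supercriticalConst μ r R Rt lam)) ∧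
    (γ < SGDVolterra.criticalStepsize μ r →
      ∀ (α : ℝ) (L : ℝ → ℝ), SGDVolterra.IsLeftEdgeRegular μ α L →
        Tendsto
          (fun t => Real.exp (2 * γ * SGDVolterra.leftEdge μ * t) *
            (ψ t - SGDVolterra.psiInfty μ r Rt γ) / (t ^ (-α) * L t))
          atTop (𝓝 (SGDVolterra.subcriticalConst μ r R Rt γ α)) ∧
        (SGDVolterra.subcriticalConst μ r R Rt γ α ≠ 0 →
          SGDVolterra.IsRegularlyVarying
            (fun t => SGDVolterra.subcriticalConst μ r R Rt γ α * t ^ (-α) * L t) ∧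
          (fun t => ψ t - SGDVolterra.psiInfty μ r Rt γ) ~[atTop]
            (fun t => Real.exp (-2 * γ * SGDVolterra.leftEdge μ * t) *
              (SGDVolterra.subcriticalConst μ r R Rt γ α * t ^ (-α) * L t))) ∧
        (0 < SGDVolterra.subcriticalConst μ r R Rt γ α ↔
          0 < SGDVolterra.signQuantity μ r R Rt γ (SGDVolterra.leftEdge μ)) ∧
        (SGDVolterra.psiInfty μ r Rt γ = 0 →
          0 < SGDVolterra.subcriticalConst μ r R Rt γ α)) := by
  obtain ⟨M, hμ⟩ := hμ
  have hm := firstMoment_pos hμ hedge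
  refine ⟨fun hcrit hmax => ?_, fun hcrit α L hL => ?_⟩
  · obtain ⟨lam₀, h0, hlt, huniq⟩ := existsUnique_resolvent_eq hμ hedge hr hγ hcrit hmax
    have hX : 0 < 1 - γ * r / 2 * firstMoment μ := by
      rw [maxStepsize, lt_inv_comm₀ hγ (by positivity), ← one_div, lt_div_iff₀ hγ] at hmax
      linarith
    have hmal : ∀ lam, IsMalthusianExponent μ r γ lam ↔ lam = lam₀ := fun lam =>
      (isMalthusianExponent_iff hμ hr hγ).trans (huniq lam)
    refine ⟨⟨lam₀, (hmal lam₀).2 rfl, fun lam h => (hmal lam).1 h⟩, fun lam hlam => ?_⟩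
    obtain rfl := (hmal lam).1 hlam
    have hF : ∫ x in Ioi 0, x ^ 2 / (x - lam) ∂μ = 2 / (γ * r) := by
      have h1 := (huniq lam).2 rfl
      rw [resolventIntegral_of_lt hμ hlt, ENNReal.ofReal_eq_ofReal_iff ?_ (by positivity)] at h1
      · exact h1
      · refine integral_nonneg_of_ae ?_
        filter_upwards [ae_restrict_mem_Icc hμ] with x hx
        exact div_nonneg (sq_nonneg _) (by linarith [hx.1])
    have hlim := supercritical_asymptotics hμ hedge hr hγ hψ h0 hlt hF hX.ne'
    have hpos := supercriticalConst_pos_iff (R := R) (Rt := Rt) hμ hedge hγ hr hX.ne' h0 hlt hF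
    refine ⟨⟨h0, hlt⟩, fun lam' _ => (resolvent_eq_iff hr hγ).trans (huniq lam'), hlim,
      fun hc => ?_, hpos, fun hpsi => hpos.2 ?_⟩
    · have hc' : supercriticalConst μ r R Rt lam / γ ≠ 0 := div_ne_zero hc hγ.ne'
      refine (isEquivalent_iff_tendsto_one (Eventually.of_forall fun t =>
        mul_ne_zero hc' (Real.exp_pos _).ne')).2 ?_
      have h1 := hlim.div_const (supercriticalConst μ r R Rt lam / γ)
      rw [div_self hc'] at h1
      refine h1.congr fun t => ?_
      rw [Pi.div_apply, show -2 * γ * lam * t = -(2 * γ * lam * t) by ring, Real.exp_neg]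
      field_simp
    · have hall : ∀ᵐ x ∂(μ.restrict (Ioi 0)), lam < x := by
        filter_upwards [ae_restrict_mem_Icc hμ] with x hx using hlt.trans_le hx.1
      have hint : Integrable (fun x => 1 / (x - lam)) (μ.restrict (Ioi 0)) :=
        integrable_resolvent_of_lt hμ hlt continuous_const
      refine signQuantity_pos_of_psiInfty_eq_zero hμ hr hR hRt hRRt h0 hX.ne' ?_ hpsi
      have h1 := measureReal_Ioi_lt_integral hedge h0 hall hint
      have h2 := integral_sq_div_sub hμ (hall.mono fun x hx => hx.ne') hint
      have h3 : 2 / γ = r * (2 / (γ * r)) := by field_simp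
      rw [h3, ← hF, h2]
      have := mul_lt_mul_of_pos_left h1 (mul_pos h0 hr)
      linarith
  · have hX' := (lt_criticalStepsize_iff hμ hedge hr hγ).1 hcrit
    have hr2 : ENNReal.ofReal (r / 2) ≠ 0 := by positivity
    have hfin : resolventIntegral μ (leftEdge μ) ≠ ⊤ := fun h => by
      rw [h, ENNReal.mul_top hr2] at hX'
      exact not_top_lt hX'
    obtain ⟨hall, hint2, hint0⟩ := subcritical_edge hμ hedge hfin
    have hcr := div_criticalStepsize_eq (γ := γ) hμ hr hall hint2
    have hI : γ * r / 2 * (∫ x in Ioi 0, x ^ 2 / (x - leftEdge μ) ∂μ) < 1 := by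
      rw [← hcr, div_lt_one (hγ.trans hcrit)]
      exact hcrit
    have hF := integral_sq_div_sub hμ (hall.mono fun x hx => hx.ne') hint0
    have hJ := measureReal_Ioi_lt_integral hedge hedge hall hint0
    have hJ0 : 0 < ∫ x in Ioi 0, x / (x - leftEdge μ) ∂μ :=
      lt_of_le_of_lt measureReal_nonneg hJ
    -- `F(e) = m + e ∫ x/(x-e)` exceeds `m`, so `γ < γ_*` already implies `γ < γ_0`.
    have hX : 0 < 1 - γ * r / 2 * firstMoment μ := by
      rw [hF] at hI
      have : 0 < γ * r / 2 * (leftEdge μ * ∫ x in Ioi 0, x / (x - leftEdge μ) ∂μ) := by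
        positivity
      linarith
    have hlim := subcritical_asymptotics hμ hedge hr hγ hψ hall hint2 hint0 hX.ne' hI hL
    have hα : 0 < α := hL.1
    have hpos : 0 < subcriticalConst μ r R Rt γ α ↔
        0 < signQuantity μ r R Rt γ (leftEdge μ) := by
      have hΓ : 0 < Real.Gamma (α + 1) := Real.Gamma_pos_of_pos (by linarith)
      have hD : 0 < 1 - γ / criticalStepsize μ r := by rw [hcr]; linarith
      rw [subcriticalConst, div_pos_iff_of_pos_right (by positivity),
        mul_pos_iff_of_pos_left (by positivity)]
    refine ⟨hlim, fun hκ => ⟨?_, ?_⟩, hpos, fun hpsi => hpos.2 ?_⟩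
    · refine ⟨-α, fun t => subcriticalConst μ r R Rt γ α * L t, hL.2.1.const_mul hκ,
        fun t _ => by ring⟩
    · have hUL := (hL.tendsto_ratio fun s hs => measureReal_Ioc_leftEdge_pos hall hedge hs).1
      have hne : ∀ᶠ t : ℝ in atTop, t ^ (-α) * L t ≠ 0 := by
        filter_upwards [hUL.eventually_ne one_ne_zero] with t ht using (div_ne_zero_iff.1 ht).2
      refine (isEquivalent_iff_tendsto_one ?_).2 ?_
      · filter_upwards [hne] with t ht
        refine mul_ne_zero (Real.exp_pos _).ne' ?_
        rw [mul_assoc]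
        exact mul_ne_zero hκ ht
      have h1 := hlim.div_const (subcriticalConst μ r R Rt γ α)
      rw [div_self hκ] at h1
      refine h1.congr fun t => ?_
      rw [Pi.div_apply, show -2 * γ * leftEdge μ * t = -(2 * γ * leftEdge μ * t) by ring,
        Real.exp_neg]
      field_simp
    · refine signQuantity_pos_of_psiInfty_eq_zero hμ hr hR hRt hRRt hedge hX.ne' ?_ hpsi
      have h2 : r * (∫ x in Ioi 0, x ^ 2 / (x - leftEdge μ) ∂μ) < 2 / γ := by
        rw [lt_div_iff₀ hγ]
        linarith
      rw [hF] at h2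
      have := mul_lt_mul_of_pos_left hJ (mul_pos hedge hr)
      linarith
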